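/- Let $d\in\{1,2,3\}$, $\nu\ge 1/2$, $0<\ell\le (\log 2)^{-1}\sqrt{\nu/(2d)}$, and let $k=C_{\nu,\ell}$ be the Matérn kernel on $\mathbb{R}^d$, $$C_{\nu,\ell}(x)=\frac{2^{1-\nu}}{\Gamma(\nu)}\Bigl(\sqrt{2\nu}\,\frac{|x|}{\ell}\Bigr)^{\nu}K_\nu\Bigl(\sqrt{2\nu}\,\frac{|x|}{\ell}\Bigr)\quad(x\ne 0),\qquad C_{\nu,\ell}(0)=1,$$ where $K_\nu$ is the modified Bessel function of the second kind and $|\cdot|$ the Euclidean norm. Let $\hat k(\xi)=\int_{\mathbb{R}^d}k(x)e^{-2\pi i\langle\xi,x\rangle}\,dx$ and, for $h>0$ and $m\in\mathbb{N}$, let $J_m=\{-m,\dots,m\}^d$ and $$\tilde k(x)=\sum_{j\in J_m}h^d\,\hat k(hj)\,e^{2\pi i h\langle j,x\rangle}.$$ Let $\varepsilon>0$, and let $h>0$ satisfy $$h\le\bigl(1+\sqrt{8\nu}\,\ell\bigr)^{-1}\quad\text{and}\quad h\le\Bigl(1+\ell\sqrt{2d/\nu}\,\log\bigl(d\,3^d/\varepsilon\bigr)\Bigr)^{-1}.$$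 Then the aliasing error is at most $\varepsilon/2$ on $[-1,1]^d$: for every $x\in[-1,1]^d$ the series below converges absolutely and $$\Bigl|\sum_{n\in\mathbb{Z}^d,\ n\ne 0}k\bigl(x+n/h\bigr)\Bigr|\le\varepsilon/2 .$$ If in addition $m\in\mathbb{N}$ satisfies $$m\ge\Bigl(\frac{d\,5^{d-1}}{\pi^{d/2}\,\varepsilon}\Bigr)^{1/(2\nu)}\cdot\frac{1.6\,\sqrt{\nu}}{\pi h\ell},$$ then the truncation error is at most $\varepsilon/2$ on $\mathbb{R}^d$: for every $x\in\mathbb{R}^d$ the series below converges absolutely and $$\Bigl|h^d\sum_{j\in\mathbb{Z}^d,\ j\notin J_m}\hat k(hj)\,e^{2\pi i h\langle j,x\rangle}\Bigr|\le\varepsilon/2 ,$$ and consequently $|\tilde k(x)-k(x)|\le\varepsilon$ for all $x\in[-1,1]^d$. -/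

import Mathlib

open scoped FourierTransform

noncomputable section

/-- The modified Bessel function of the second kind `K_ν(z)`, for real `z > 0`,
through its integral representation. -/
def besselK (ν z : ℝ) : ℝ :=
  ∫ t in Set.Ioi (0 : ℝ), Real.exp (-z * Real.cosh t) * Real.cosh (ν * t)

/-- The Matérn kernel `C_{ν,ℓ}` on `ℝ^d`. The defining formula is of the form `0 · ∞` at the
origin, where the kernel takes its limiting value `1`. -/
def matern {d : ℕ} (ν ℓ : ℝ) (x : EuclideanSpace ℝ (Fin d)) : ℝ :=
  if x = 0 then 1
  else
    (2 : ℝ) ^ (1 - ν) / Real.Gamma ν * (Real.sqrt (2 * ν) * (‖x‖ / ℓ)) ^ ν *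
      besselK ν (Real.sqrt (2 * ν) * (‖x‖ / ℓ))

/-- The integer multi-index `j ∈ ℤ^d` as a point of `ℝ^d`. -/
def latticePoint {d : ℕ} (j : Fin d → ℤ) : EuclideanSpace ℝ (Fin d) :=
  WithLp.toLp 2 fun i => (j i : ℝ)

/-- The box `J_m = {-m, …, m}^d` of multi-indices. -/
def indexBox (d m : ℕ) : Finset (Fin d → ℤ) :=
  Fintype.piFinset fun _ => Finset.Icc (-(m : ℤ)) (m : ℤ)

/-- The Fourier transform `ξ ↦ ∫ k(x) e^{-2πi⟨ξ,x⟩} dx` of a real kernel on `ℝ^d`. -/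
def kernelFourier {d : ℕ} (k : EuclideanSpace ℝ (Fin d) → ℝ) :
    EuclideanSpace ℝ (Fin d) → ℂ :=
  𝓕 fun x => (k x : ℂ)

/-- The Fourier mode `h^d k̂(hj) e^{2πi h⟨j,x⟩}` with multi-index `j`. -/
def fourierMode {d : ℕ} (k : EuclideanSpace ℝ (Fin d) → ℝ) (h : ℝ)
    (x : EuclideanSpace ℝ (Fin d)) (j : Fin d → ℤ) : ℂ :=
  (h : ℂ) ^ d * kernelFourier k (h • latticePoint j) *
    Complex.exp (2 * Real.pi * Complex.I * h * (inner ℝ (latticePoint j) x : ℝ))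

/-- The equispaced Fourier approximation `k̃` of `k`: the sum of the modes in `J_m`. -/
def equispacedFourier {d : ℕ} (k : EuclideanSpace ℝ (Fin d) → ℝ) (h : ℝ) (m : ℕ)
    (x : EuclideanSpace ℝ (Fin d)) : ℂ :=
  ∑ j ∈ indexBox d m, fourierMode k h x j

/-- The terms `k(x + n/h)`, `n ∈ ℤ^d ∖ {0}`, of the aliasing error. -/
def aliasingTerm {d : ℕ} (k : EuclideanSpace ℝ (Fin d) → ℝ) (h : ℝ)
    (x : EuclideanSpace ℝ (Fin d)) (n : {n : Fin d → ℤ // n ≠ 0}) : ℝ :=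
  k (x + h⁻¹ • latticePoint n.1)

/-- The terms `h^d k̂(hj) e^{2πi h⟨j,x⟩}`, `j ∈ ℤ^d ∖ J_m`, of the truncation error. -/
def truncationTerm {d : ℕ} (k : EuclideanSpace ℝ (Fin d) → ℝ) (h : ℝ) (m : ℕ)
    (x : EuclideanSpace ℝ (Fin d)) (j : {j : Fin d → ℤ // j ∉ indexBox d m}) : ℂ :=
  fourierMode k h x j.1

/-- The cube `[-1,1]^d`. -/
def cube (d : ℕ) : Set (EuclideanSpace ℝ (Fin d)) :=
  {x | ∀ i, x i ∈ Set.Icc (-1 : ℝ) 1}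

end

open MeasureTheory Real Set

/-! The Matérn kernel is a Gamma mixture of Gaussians: substituting s = (z/2)e^t in the Bessel
integral gives k(x) = E[exp(-κ|x|²/s)] with s Gamma-distributed of shape ν and κ = ν/(2ℓ²)
(`matern_eq_integral`). Positivity, the closed form of k̂ (`kernelFourier_matern`), decay of k and
Poisson summation (`tsum_matern_eq_tsum_fourierMode`) are all read off from Gaussians by integrating
in s. Poisson summation turns k̃ - k into the aliasing sum minus the truncation sum
(`equispacedFourier_sub_matern`), so it suffices to bound each by ε/2.

Aliasing: the bounds on h put every nonzero shift where k is at most 23/25 · e^{-z/2}, z =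
√(2ν)|y|/ℓ (`matern_le_exp`). Since √d|y| ≥ Σ|y_i|, this exponential is dominated by a product over
coordinates, and the lattice sum by a d-th power of geometric series minus the term n = 0. The
outcome is d3^d/2 · q with q = exp(-√(ν/(2d))(1/h - 1)/ℓ), and the second bound on h says q ≤
ε/(d3^d).

Truncation: the modes have modulus h^d k̂(hj), which decays like |j|^{-(2ν+d)}. Summing over the
cubical shells |j|_∞ = s telescopes to a multiple of m^{-2ν} (`summable_and_tsum_off_indexBox_le`).
Log-convexity of Γ absorbs the remaining constants into the factor 1.6 in the bound on m
(`exists_shell_constant`). -/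

/-! ### The Bessel function as an integral over the half-line -/

theorem integrableOn_rpow_mul_exp_neg_mul {a r : ℝ} (ha : 0 < a) (hr : 0 < r) :
    IntegrableOn (fun s : ℝ => s ^ (a - 1) * exp (-(r * s))) (Ioi 0) := by
  have := integrableOn_rpow_mul_exp_neg_mul_rpow (p := 1) (s := a - 1) (b := r)
    (by linarith) one_pos hr
  simpa [neg_mul] using this

theorem integrableOn_rpow_mul_exp_neg_sub_div {ν c : ℝ} (hν : 0 < ν) (hc : 0 ≤ c) :
    IntegrableOn (fun s : ℝ => s ^ (ν - 1) * exp (-s - c / s)) (Ioi 0) := by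
  have h := integrableOn_rpow_mul_exp_neg_mul hν one_pos
  refine h.mono' (Measurable.aestronglyMeasurable (by fun_prop)) ?_
  filter_upwards [ae_restrict_mem measurableSet_Ioi] with s hs
  have hs : 0 < s := hs
  rw [norm_of_nonneg (by positivity)]
  gcongr
  have : 0 ≤ c / s := by positivity
  linarith

theorem image_mul_exp_univ {c : ℝ} (hc : 0 < c) : (fun t => c * exp t) '' univ = Ioi 0 := by
  ext y
  simp only [image_univ, mem_range, mem_Ioi]
  constructor
  · rintro ⟨t, rfl⟩
    positivity
  · intro hy
    exact ⟨log (y / c), by rw [exp_log (by positivity)]; field_simp⟩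

/-- Substituting s = (z/2)e^t turns s + z²/(4s) into z cosh t. -/
theorem abs_deriv_smul_comp_mul_exp {ν z : ℝ} (hz : 0 < z) (t : ℝ) :
    |z / 2 * exp t| • ((z / 2 * exp t) ^ (ν - 1) *
        exp (-(z / 2 * exp t) - z ^ 2 / 4 / (z / 2 * exp t))) =
      (z / 2) ^ ν * (exp (-z * cosh t) * exp (ν * t)) := by
  have hpos : 0 < z / 2 * exp t := by positivity
  have h1 : z / 2 * exp t * (z / 2 * exp t) ^ (ν - 1) = (z / 2) ^ ν * exp (ν * t) := by
    rw [rpow_sub_one hpos.ne', mul_div_cancel₀ _ hpos.ne', mul_rpow (by positivity) (by positivity),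
      ← exp_mul, mul_comm t]
  have h2 : -(z / 2 * exp t) - z ^ 2 / 4 / (z / 2 * exp t) = -z * cosh t := by
    rw [cosh_eq, exp_neg]
    field_simp
    ring
  rw [abs_of_pos hpos, smul_eq_mul, ← mul_assoc, h1, h2]
  ring

theorem integrable_exp_neg_mul_cosh_mul_exp {ν z : ℝ} (hν : 0 < ν) (hz : 0 < z) :
    Integrable fun t => exp (-z * cosh t) * exp (ν * t) := by
  have hderiv : ∀ t ∈ univ, HasDerivWithinAt (fun t => z / 2 * exp t) (z / 2 * exp t) univ t :=
    fun t _ => ((hasDerivAt_exp t).const_mul _).hasDerivWithinAt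
  have hinj : InjOn (fun t => z / 2 * exp t) univ := fun a _ b _ hab =>
    exp_injective (mul_left_cancel₀ (by positivity : z / 2 ≠ 0) hab)
  have h := integrableOn_rpow_mul_exp_neg_sub_div (c := z ^ 2 / 4) hν (by positivity)
  rw [← image_mul_exp_univ (by positivity : 0 < z / 2),
    integrableOn_image_iff_integrableOn_abs_deriv_smul MeasurableSet.univ hderiv hinj] at h
  simp only [abs_deriv_smul_comp_mul_exp hz, integrableOn_univ] at h
  exact (integrable_const_mul_iff (isUnit_iff_ne_zero.2 (by positivity)) _).1 h

theorem integral_exp_neg_mul_cosh_mul_exp {ν z : ℝ} (hν : 0 < ν) (hz : 0 < z) :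
    ∫ t, exp (-z * cosh t) * exp (ν * t) = 2 * besselK ν z := by
  set f : ℝ → ℝ := fun t => exp (-z * cosh t) * exp (ν * t)
  have hf : Integrable f := integrable_exp_neg_mul_cosh_mul_exp hν hz
  have hneg : ∫ t in Iic 0, f t = ∫ t in Ioi 0, f (-t) := by
    have := integral_comp_neg_Ioi 0 f
    rw [this, neg_zero]
  rw [← integral_add_compl (measurableSet_Ioi (a := (0 : ℝ))) hf, compl_Ioi, hneg,
    ← integral_add hf.integrableOn hf.comp_neg.integrableOn, besselK, ← integral_const_mul]
  congr 1
  ext t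
  simp only [f, cosh_neg, cosh_eq (ν * t), mul_neg]
  ring

/-- The modified Bessel function as a Laplace-type integral. -/
theorem rpow_mul_besselK {ν z : ℝ} (hν : 0 < ν) (hz : 0 < z) :
    2 ^ (1 - ν) * z ^ ν * besselK ν z =
      ∫ s in Ioi (0 : ℝ), s ^ (ν - 1) * exp (-s - z ^ 2 / 4 / s) := by
  have hderiv : ∀ t ∈ univ, HasDerivWithinAt (fun t => z / 2 * exp t) (z / 2 * exp t) univ t :=
    fun t _ => ((hasDerivAt_exp t).const_mul _).hasDerivWithinAt
  have hinj : InjOn (fun t => z / 2 * exp t) univ := fun a _ b _ hab =>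
    exp_injective (mul_left_cancel₀ (by positivity : z / 2 ≠ 0) hab)
  rw [← image_mul_exp_univ (by positivity : 0 < z / 2),
    integral_image_eq_integral_abs_deriv_smul MeasurableSet.univ hderiv hinj]
  simp only [abs_deriv_smul_comp_mul_exp hz, setIntegral_univ]
  rw [integral_const_mul, integral_exp_neg_mul_cosh_mul_exp hν hz, div_rpow hz.le zero_le_two,
    rpow_sub two_pos, rpow_one]
  ring

/-! ### The Matérn kernel as a Gamma mixture of Gaussians -/

/-- The density of the Gamma distribution with shape `ν` and rate `1`. -/
noncomputable def gammaWeight (ν s : ℝ) : ℝ :=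
  s ^ (ν - 1) * exp (-s) / Gamma ν

/-- The coefficient `κ` for which the Matérn kernel is a mixture of the Gaussians
`exp (-κ |x|² / s)`. -/
noncomputable def maternRate (ν ℓ : ℝ) : ℝ :=
  ν / (2 * ℓ ^ 2)

theorem maternRate_pos {ν ℓ : ℝ} (hν : 0 < ν) (hℓ : 0 < ℓ) : 0 < maternRate ν ℓ := by
  unfold maternRate
  positivity

theorem gammaWeight_nonneg {ν s : ℝ} (hν : 0 < ν) (hs : 0 < s) : 0 ≤ gammaWeight ν s := by
  have := Gamma_pos_of_pos hν
  unfold gammaWeight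
  positivity

theorem measurable_gammaWeight (ν : ℝ) : Measurable (gammaWeight ν) := by
  unfold gammaWeight
  fun_prop

theorem gammaWeight_mul_rpow_mul_exp {ν p r s : ℝ} (hs : 0 < s) :
    gammaWeight ν s * (s ^ p * exp (-(r * s))) =
      (Gamma ν)⁻¹ * (s ^ (ν + p - 1) * exp (-((1 + r) * s))) := by
  rw [gammaWeight, show ν + p - 1 = (ν - 1) + p by ring, rpow_add hs,
    show -((1 + r) * s) = -s + -(r * s) by ring, exp_add]
  ring

theorem integrableOn_gammaWeight_mul_rpow_mul_exp {ν p r : ℝ} (hνp : 0 < ν + p) (hr : 0 < 1 + r) :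
    IntegrableOn (fun s => gammaWeight ν s * (s ^ p * exp (-(r * s)))) (Ioi 0) := by
  have h := (integrableOn_rpow_mul_exp_neg_mul hνp hr).const_mul (Gamma ν)⁻¹
  exact IntegrableOn.congr_fun h (fun s hs => (gammaWeight_mul_rpow_mul_exp hs).symm) measurableSet_Ioi

/-- Tilting a Gamma density by s^p e^{-rs} leaves a Gamma integral. It serves three times: p = r = 0
for the total mass, p = d/2 for the spectrum, r = -9/16 for the decay of the kernel. -/
theorem integral_gammaWeight_mul_rpow_mul_exp {ν p r : ℝ} (hνp : 0 < ν + p) (hr : 0 < 1 + r) :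
    ∫ s in Ioi 0, gammaWeight ν s * (s ^ p * exp (-(r * s))) =
      Gamma (ν + p) / Gamma ν * (1 + r) ^ (-(ν + p)) := by
  rw [setIntegral_congr_fun measurableSet_Ioi
    (fun s hs => gammaWeight_mul_rpow_mul_exp (ν := ν) (p := p) (r := r) hs), integral_const_mul,
    integral_rpow_mul_exp_neg_mul_Ioi hνp (by linarith), rpow_neg (by linarith),
    one_div, inv_rpow (by linarith)]
  ring

theorem integrableOn_gammaWeight {ν : ℝ} (hν : 0 < ν) : IntegrableOn (gammaWeight ν) (Ioi 0) := by
  simpa using integrableOn_gammaWeight_mul_rpow_mul_exp (p := 0) (r := 0) (by simpa) (by norm_num)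

theorem integral_gammaWeight {ν : ℝ} (hν : 0 < ν) : ∫ s in Ioi 0, gammaWeight ν s = 1 := by
  simpa [(Gamma_pos_of_pos hν).ne'] using
    integral_gammaWeight_mul_rpow_mul_exp (ν := ν) (p := 0) (r := 0) (by simpa) (by norm_num)

theorem integrableOn_gammaWeight_mul_exp_neg_div {ν c : ℝ} (hν : 0 < ν) (hc : 0 ≤ c) :
    IntegrableOn (fun s => gammaWeight ν s * exp (-(c / s))) (Ioi 0) := by
  refine (integrableOn_gammaWeight hν).mono'
    (((measurable_gammaWeight ν).mul (by fun_prop)).aestronglyMeasurable) ?_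
  filter_upwards [ae_restrict_mem measurableSet_Ioi] with s hs
  have hs : 0 < s := hs
  have hw := gammaWeight_nonneg hν hs
  rw [norm_of_nonneg (by positivity)]
  exact mul_le_of_le_one_right hw (exp_le_one_iff.2 (neg_nonpos.2 (by positivity)))

/-- The Matérn kernel is a Gamma mixture of Gaussians. -/
theorem matern_eq_integral {d : ℕ} {ν ℓ : ℝ} (hν : 0 < ν) (hℓ : 0 < ℓ)
    (x : EuclideanSpace ℝ (Fin d)) :
    matern ν ℓ x =
      ∫ s in Ioi 0, gammaWeight ν s * exp (-(maternRate ν ℓ * ‖x‖ ^ 2 / s)) := by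
  by_cases hx : x = 0
  · simp [matern, hx, integral_gammaWeight hν]
  · have hx' : 0 < ‖x‖ := norm_pos_iff.2 hx
    set z := √(2 * ν) * (‖x‖ / ℓ) with hz
    have hzpos : 0 < z := by positivity
    have hz2 : z ^ 2 / 4 = maternRate ν ℓ * ‖x‖ ^ 2 := by
      rw [hz, mul_pow, sq_sqrt (by positivity), maternRate]
      field_simp
      ring
    have := rpow_mul_besselK hν hzpos
    rw [matern, if_neg hx, ← hz, div_mul_eq_mul_div, div_mul_eq_mul_div, this, hz2,
      ← integral_div]
    congr 1
    ext s
    rw [gammaWeight, sub_eq_add_neg (-s), exp_add]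
    ring

theorem matern_nonneg {d : ℕ} {ν ℓ : ℝ} (hν : 0 < ν) (hℓ : 0 < ℓ)
    (x : EuclideanSpace ℝ (Fin d)) : 0 ≤ matern ν ℓ x := by
  rw [matern_eq_integral hν hℓ]
  exact setIntegral_nonneg measurableSet_Ioi
    fun s hs => mul_nonneg (gammaWeight_nonneg hν hs) (exp_pos _).le

/-! ### The Fourier transform of the kernel -/

/-- The closed form of the Fourier transform of the Matérn kernel. -/
noncomputable def maternSpectrum (d : ℕ) (ν ℓ r : ℝ) : ℝ :=
  (π / maternRate ν ℓ) ^ ((d : ℝ) / 2) * (Gamma (ν + d / 2) / Gamma ν) *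
    (1 + π ^ 2 * r ^ 2 / maternRate ν ℓ) ^ (-(ν + d / 2))

theorem maternSpectrum_nonneg {d : ℕ} {ν ℓ : ℝ} (hν : 0 < ν) (hℓ : 0 < ℓ) (r : ℝ) :
    0 ≤ maternSpectrum d ν ℓ r := by
  have := maternRate_pos hν hℓ
  have := Gamma_pos_of_pos hν
  have := Gamma_pos_of_pos (by positivity : 0 < ν + d / 2)
  unfold maternSpectrum
  positivity

/-- The Fourier transform of `exp (-κ |x|² / s)` as a function of `r = |ξ|`. -/
noncomputable def gaussianSpectrum (d : ℕ) (κ r s : ℝ) : ℝ :=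
  (π / κ) ^ ((d : ℝ) / 2) * (s ^ ((d : ℝ) / 2) * exp (-(π ^ 2 * r ^ 2 / κ * s)))

theorem integrableOn_gammaWeight_mul_gaussianSpectrum (d : ℕ) {ν κ : ℝ} (hν : 0 < ν) (hκ : 0 < κ)
    (r : ℝ) : IntegrableOn (fun s => gammaWeight ν s * gaussianSpectrum d κ r s) (Ioi 0) := by
  have h := (integrableOn_gammaWeight_mul_rpow_mul_exp (ν := ν) (p := (d : ℝ) / 2)
    (r := π ^ 2 * r ^ 2 / κ) (by positivity) (by positivity)).const_mul
    ((π / κ) ^ ((d : ℝ) / 2))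
  refine IntegrableOn.congr_fun h (fun s _ => ?_) measurableSet_Ioi
  simp only [gaussianSpectrum]
  ring

theorem integral_gammaWeight_mul_gaussianSpectrum (d : ℕ) {ν ℓ : ℝ} (hν : 0 < ν) (hℓ : 0 < ℓ)
    (r : ℝ) :
    ∫ s in Ioi 0, gammaWeight ν s * gaussianSpectrum d (maternRate ν ℓ) r s =
      maternSpectrum d ν ℓ r := by
  have hκ := maternRate_pos hν hℓ
  have h := integral_gammaWeight_mul_rpow_mul_exp (ν := ν) (p := (d : ℝ) / 2)
    (r := π ^ 2 * r ^ 2 / maternRate ν ℓ) (by positivity) (by positivity)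
  rw [maternSpectrum, mul_assoc, ← h, ← integral_const_mul]
  congr 1
  ext s
  simp only [gaussianSpectrum]
  ring

theorem gaussianSpectrum_nonneg {d : ℕ} {κ r s : ℝ} (hκ : 0 < κ) (hs : 0 < s) :
    0 ≤ gaussianSpectrum d κ r s := by
  unfold gaussianSpectrum
  positivity

theorem fourier_exp_neg_mul_sq_norm_div {d : ℕ} {κ s : ℝ} (hκ : 0 < κ) (hs : 0 < s)
    (ξ : EuclideanSpace ℝ (Fin d)) :
    𝓕 (fun x : EuclideanSpace ℝ (Fin d) => ((exp (-(κ * ‖x‖ ^ 2 / s)) : ℝ) : ℂ)) ξ =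
      (gaussianSpectrum d κ ‖ξ‖ s : ℝ) := by
  have h := fourier_gaussian_innerProductSpace (b := ((κ / s : ℝ) : ℂ))
    (by rw [Complex.ofReal_re]; positivity) ξ
  have e : (fun x : EuclideanSpace ℝ (Fin d) => ((exp (-(κ * ‖x‖ ^ 2 / s)) : ℝ) : ℂ)) =
      fun x => Complex.exp (-((κ / s : ℝ) : ℂ) * (‖x‖ : ℂ) ^ 2) := by
    ext x
    push_cast
    congr 1
    ring
  rw [e, h, finrank_euclideanSpace_fin, gaussianSpectrum, ← mul_assoc,
    ← mul_rpow (by positivity) hs.le]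
  push_cast
  rw [Complex.ofReal_cpow (by positivity)]
  congr 1
  · congr 1
    · push_cast
      field_simp
    · push_cast
      ring
  · congr 1
    field_simp

theorem integrable_exp_neg_mul_sq_norm_div {d : ℕ} {κ s : ℝ} (hκ : 0 < κ) (hs : 0 < s) :
    Integrable fun x : EuclideanSpace ℝ (Fin d) => exp (-(κ * ‖x‖ ^ 2 / s)) := by
  have h := (GaussianFourier.integrable_cexp_neg_mul_sq_norm_add (b := ((κ / s : ℝ) : ℂ))
    (by rw [Complex.ofReal_re]; positivity) 0 (0 : EuclideanSpace ℝ (Fin d))).re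
  refine h.congr (Filter.Eventually.of_forall fun x => ?_)
  have : -((κ / s : ℝ) : ℂ) * (‖x‖ : ℂ) ^ 2 + 0 * ((inner ℝ (0 : EuclideanSpace ℝ (Fin d)) x : ℝ) : ℂ)
      = ((-(κ * ‖x‖ ^ 2 / s) : ℝ) : ℂ) := by
    push_cast
    ring
  simp only [this, ← Complex.ofReal_exp]
  exact Complex.ofReal_re _

theorem integral_exp_neg_mul_sq_norm_div {d : ℕ} {κ s : ℝ} (hκ : 0 < κ) (hs : 0 < s) :
    ∫ x : EuclideanSpace ℝ (Fin d), exp (-(κ * ‖x‖ ^ 2 / s)) = gaussianSpectrum d κ 0 s := by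
  have h := GaussianFourier.integral_rexp_neg_mul_sq_norm (V := EuclideanSpace ℝ (Fin d))
    (by positivity : 0 < κ / s)
  rw [finrank_euclideanSpace_fin] at h
  rw [gaussianSpectrum, ← mul_assoc, ← mul_rpow (by positivity) hs.le]
  convert h using 1
  · congr 1
    ext x
    ring_nf
  · simp
    congr 1
    field_simp

/-- Fubini on the mixture: each Gaussian has a Gaussian transform, and what remains in s is a Gamma
integral. -/
theorem kernelFourier_matern {d : ℕ} {ν ℓ : ℝ} (hν : 0 < ν) (hℓ : 0 < ℓ)
    (ξ : EuclideanSpace ℝ (Fin d)) :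
    kernelFourier (matern ν ℓ) ξ = (maternSpectrum d ν ℓ ‖ξ‖ : ℝ) := by
  have hκ := maternRate_pos hν hℓ
  set κ := maternRate ν ℓ with hκdef
  let F : ℝ → EuclideanSpace ℝ (Fin d) → ℂ := fun s x =>
    (gammaWeight ν s : ℂ) * (𝐞 (-inner ℝ x ξ) • ((exp (-(κ * ‖x‖ ^ 2 / s)) : ℝ) : ℂ))
  have hnorm : ∀ s ∈ Ioi (0 : ℝ), ∀ x, ‖F s x‖ = gammaWeight ν s * exp (-(κ * ‖x‖ ^ 2 / s)) := by
    intro s hs x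
    simp only [F, norm_mul, Circle.norm_smul, Complex.norm_real,
      norm_of_nonneg (gammaWeight_nonneg hν hs), norm_of_nonneg (exp_pos _).le]
  have hmeas : AEStronglyMeasurable (Function.uncurry F)
      ((volume.restrict (Ioi 0)).prod volume) := by
    refine Measurable.aestronglyMeasurable ?_
    have := measurable_gammaWeight ν
    simp only [Function.uncurry_def, F, Circle.smul_def, smul_eq_mul, Real.fourierChar_apply]
    fun_prop
  have hint : Integrable (Function.uncurry F) ((volume.restrict (Ioi 0)).prod volume) := by
    rw [integrable_prod_iff hmeas]
    constructor
    · filter_upwards [ae_restrict_mem measurableSet_Ioi] with s hs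
      have hs : 0 < s := hs
      have hg : Integrable fun x : EuclideanSpace ℝ (Fin d) =>
          𝐞 (-inner ℝ x ξ) • ((exp (-(κ * ‖x‖ ^ 2 / s)) : ℝ) : ℂ) :=
        (Real.fourierIntegral_convergent_iff ξ).2
          (integrable_exp_neg_mul_sq_norm_div hκ hs).ofReal
      exact hg.const_mul (gammaWeight ν s : ℂ)
    -- The x-integral of the norm is the Gaussian spectrum at frequency 0.
    · refine (integrableOn_gammaWeight_mul_gaussianSpectrum d hν hκ 0).congr_fun
        (fun s hs => ?_) measurableSet_Ioi
      simp only [Function.uncurry_apply_pair, hnorm s hs]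
      rw [integral_const_mul, integral_exp_neg_mul_sq_norm_div hκ hs]
  calc kernelFourier (matern ν ℓ) ξ
      = ∫ x, ∫ s in Ioi 0, F s x := by
        rw [kernelFourier, Real.fourier_eq]
        congr 1
        ext x
        rw [matern_eq_integral hν hℓ, ← integral_complex_ofReal, Circle.smul_def, smul_eq_mul,
          ← integral_const_mul]
        congr 1
        ext s
        simp only [F, Circle.smul_def, smul_eq_mul]
        push_cast
        ring
    _ = ∫ s in Ioi 0, ∫ x, F s x := (integral_integral_swap hint).symm
    _ = ∫ s in Ioi 0, ((gammaWeight ν s * gaussianSpectrum d κ ‖ξ‖ s : ℝ) : ℂ) := by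
        refine setIntegral_congr_fun measurableSet_Ioi fun s hs => ?_
        simp only [F]
        rw [integral_const_mul, ← Real.fourier_eq, fourier_exp_neg_mul_sq_norm_div hκ hs]
        push_cast
        ring
    _ = _ := by
        rw [integral_complex_ofReal, integral_gammaWeight_mul_gaussianSpectrum d hν hℓ]

/-! ### Products of series and Poisson summation -/

/-- Induction on d, splitting off the first coordinate. It reduces both the Gaussian Poisson formula
and the aliasing majorant to one dimension. -/
theorem summable_norm_prod_and_tsum_prod {R : Type*} [NormedField R] [CompleteSpace R] {d : ℕ}
    (f : Fin d → ℤ → R) (hf : ∀ i, Summable fun n => ‖f i n‖) :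
    (Summable fun n : Fin d → ℤ => ‖∏ i, f i (n i)‖) ∧
      ∑' n : Fin d → ℤ, ∏ i, f i (n i) = ∏ i, ∑' n, f i n := by
  induction d with
  | zero => exact ⟨Summable.of_finite, by simp⟩
  | succ d ih =>
    obtain ⟨ih₁, ih₂⟩ := ih (fun i => f i.succ) fun i => hf i.succ
    let e := Fin.consEquiv fun _ : Fin (d + 1) => ℤ
    have he : ∀ p : ℤ × (Fin d → ℤ),
        ∏ i, f i (e p i) = f 0 p.1 * ∏ i : Fin d, f i.succ (p.2 i) := fun p => by
      simp [e, Fin.prod_univ_succ, Fin.consEquiv]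
    constructor
    · rw [← e.summable_iff]
      have := (hf 0).mul_norm ih₁
      refine this.congr fun p => ?_
      rw [Function.comp_apply, he]
    · rw [← e.tsum_eq, Fin.prod_univ_succ, ← ih₂, tsum_mul_tsum_of_summable_norm (hf 0) ih₁]
      exact tsum_congr he

theorem summable_norm_cexp_quadratic {a : ℝ} (ha : 0 < a) (z : ℂ) :
    Summable fun n : ℤ =>
      ‖Complex.exp (2 * π * Complex.I * n * z + π * Complex.I * n ^ 2 * (a * Complex.I))‖ := by
  have h := (summable_jacobiTheta₂_term_iff z (a * Complex.I)).2 (by simpa using ha)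
  simpa only [jacobiTheta₂_term] using h.norm

theorem summable_exp_neg_mul_add_sq {c h : ℝ} (hc : 0 < c) (hh : 0 < h) (t : ℝ) :
    Summable fun n : ℤ => exp (-(c * (t + h⁻¹ * n) ^ 2)) := by
  have hs := (summable_norm_cexp_quadratic (a := c / (π * h ^ 2)) (by positivity)
    ((c * t / (π * h) : ℝ) * Complex.I)).mul_left (exp (-(c * t ^ 2)))
  refine hs.congr fun n => ?_
  have hI : Complex.I ^ 2 = -1 := Complex.I_sq
  have : 2 * π * Complex.I * n * ((c * t / (π * h) : ℝ) * Complex.I) +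
      π * Complex.I * n ^ 2 * ((c / (π * h ^ 2) : ℝ) * Complex.I) =
      ((-(2 * c * t * n / h + c * n ^ 2 / h ^ 2) : ℝ) : ℂ) := by
    have hpi : (π : ℂ) ≠ 0 := by exact_mod_cast pi_ne_zero
    have hh' : (h : ℂ) ≠ 0 := by exact_mod_cast hh.ne'
    push_cast
    field_simp
    rw [hI]
    ring
  rw [this, ← Complex.ofReal_exp, Complex.norm_real, norm_of_nonneg (exp_pos _).le, ← exp_add]
  congr 1
  field_simp
  ring

theorem summable_norm_cexp_neg_mul_sq_add {c h : ℝ} (hc : 0 < c) (hh : 0 < h) (t : ℝ) :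
    Summable fun n : ℤ => ‖Complex.exp (-(π ^ 2 * (h * n) ^ 2 / c) +
      2 * π * Complex.I * h * (n * t))‖ := by
  refine (summable_norm_cexp_quadratic (a := π * h ^ 2 / c) (by positivity) (h * t)).congr
    fun n => ?_
  congr 2
  have hI : Complex.I ^ 2 = -1 := Complex.I_sq
  push_cast
  linear_combination (π ^ 2 * h ^ 2 * n ^ 2 / c : ℂ) * hI

/-- Poisson summation for a Gaussian on the line. -/
theorem tsum_exp_neg_mul_add_sq {c h : ℝ} (hc : 0 < c) (hh : 0 < h) (t : ℝ) :
    ∑' n : ℤ, ((exp (-(c * (t + h⁻¹ * n) ^ 2)) : ℝ) : ℂ) =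
      ∑' n : ℤ, (h : ℂ) * ((π / c) ^ (1 / 2 : ℝ) : ℝ) *
        Complex.exp (-(π ^ 2 * (h * n) ^ 2 / c) + 2 * π * Complex.I * h * (n * t)) := by
  have hI : Complex.I ^ 2 = -1 := Complex.I_sq
  have hpi : (π : ℂ) ≠ 0 := by exact_mod_cast pi_ne_zero
  have hh' : (h : ℂ) ≠ 0 := by exact_mod_cast hh.ne'
  have hc' : (c : ℂ) ≠ 0 := by exact_mod_cast hc.ne'
  have key := Complex.tsum_exp_neg_quadratic (a := ((π * h ^ 2 / c : ℝ) : ℂ))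
    (by rw [Complex.ofReal_re]; positivity) (Complex.I * h * t)
  have hroot : (h : ℂ) * ((π / c) ^ (1 / 2 : ℝ) : ℝ) =
      ((π * h ^ 2 / c : ℝ) : ℂ) ^ (1 / 2 : ℂ) := by
    rw [show (1 / 2 : ℂ) = ((1 / 2 : ℝ) : ℂ) by push_cast; rfl,
      ← Complex.ofReal_cpow (by positivity), ← Complex.ofReal_mul]
    congr 1
    rw [show π * h ^ 2 / c = h ^ 2 * (π / c) by ring, mul_rpow (by positivity) (by positivity),
      ← rpow_natCast, ← rpow_mul hh.le]
    norm_num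
  have hne : ((π * h ^ 2 / c : ℝ) : ℂ) ^ (1 / 2 : ℂ) ≠ 0 := by
    rw [← hroot]
    have : 0 < h * (π / c) ^ (1 / 2 : ℝ) := by positivity
    exact_mod_cast this.ne'
  rw [tsum_mul_left, hroot]
  have hF : ∑' n : ℤ, Complex.exp (-(π ^ 2 * (h * n) ^ 2 / c) + 2 * π * Complex.I * h * (n * t)) =
      ∑' n : ℤ, Complex.exp (-π * ((π * h ^ 2 / c : ℝ) : ℂ) * n ^ 2 +
        2 * π * (Complex.I * h * t) * n) := by
    refine tsum_congr fun n => ?_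
    congr 1
    push_cast
    ring
  -- The functional equation produces (n - ht)², so the sum is reflected by n ↦ -n to reach (n +
  -- ht)².
  rw [hF, key, ← mul_assoc, mul_one_div_cancel hne, one_mul, ← (Equiv.neg ℤ).tsum_eq]
  refine tsum_congr fun n => ?_
  push_cast [Equiv.neg_apply]
  congr 1
  have e : Complex.I * (Complex.I * h * t) = -(h * t : ℂ) := by
    linear_combination (h * t : ℂ) * hI
  rw [e]
  field_simp
  ring

theorem norm_add_inv_smul_latticePoint_sq {d : ℕ} (h : ℝ) (x : EuclideanSpace ℝ (Fin d))
    (n : Fin d → ℤ) :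
    ‖x + h⁻¹ • latticePoint n‖ ^ 2 = ∑ i, (x i + h⁻¹ * n i) ^ 2 := by
  simp [EuclideanSpace.norm_sq_eq, latticePoint]

theorem norm_smul_latticePoint_sq {d : ℕ} (h : ℝ) (n : Fin d → ℤ) :
    ‖h • latticePoint n‖ ^ 2 = ∑ i, (h * n i) ^ 2 := by
  simp [EuclideanSpace.norm_sq_eq, latticePoint, mul_pow]

theorem inner_latticePoint {d : ℕ} (x : EuclideanSpace ℝ (Fin d)) (n : Fin d → ℤ) :
    inner ℝ (latticePoint n) x = ∑ i, n i * x i := by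
  simp [PiLp.inner_apply, latticePoint, mul_comm]

/-- Poisson summation for a Gaussian on `ℝ^d`. -/
theorem tsum_exp_neg_mul_sq_norm_add {d : ℕ} {κ s h : ℝ} (hκ : 0 < κ) (hs : 0 < s) (hh : 0 < h)
    (x : EuclideanSpace ℝ (Fin d)) :
    ∑' n : Fin d → ℤ, ((exp (-(κ * ‖x + h⁻¹ • latticePoint n‖ ^ 2 / s)) : ℝ) : ℂ) =
      ∑' j : Fin d → ℤ, (h : ℂ) ^ d * (gaussianSpectrum d κ ‖h • latticePoint j‖ s : ℝ) *
        Complex.exp (2 * π * Complex.I * h * (inner ℝ (latticePoint j) x : ℝ)) := by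
  have hc : 0 < κ / s := by positivity
  set c := κ / s with hcdef
  have hL := (summable_norm_prod_and_tsum_prod (d := d)
    (fun i (n : ℤ) => ((exp (-(c * (x i + h⁻¹ * n) ^ 2)) : ℝ) : ℂ)) fun i => by
      simpa only [Complex.norm_real] using (summable_exp_neg_mul_add_sq hc hh (x i)).norm).2
  have hR := (summable_norm_prod_and_tsum_prod (d := d)
    (fun i (n : ℤ) => (h : ℂ) * ((π / c) ^ (1 / 2 : ℝ) : ℝ) *
        Complex.exp (-(π ^ 2 * (h * n) ^ 2 / c) + 2 * π * Complex.I * h * (n * x i))) fun i => by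
      simpa only [norm_mul] using
        (summable_norm_cexp_neg_mul_sq_add hc hh (x i)).mul_left
          (‖(h : ℂ)‖ * ‖(((π / c) ^ (1 / 2 : ℝ) : ℝ) : ℂ)‖)).2
  simp only [tsum_exp_neg_mul_add_sq hc hh] at hL
  have hLR := hL.trans hR.symm
  convert hLR using 1
  · refine tsum_congr fun n => ?_
    rw [← Complex.ofReal_prod, ← exp_sum, norm_add_inv_smul_latticePoint_sq,
      Finset.sum_neg_distrib, ← Finset.mul_sum, hcdef]
    congr 3
    ring
  · refine tsum_congr fun j => ?_
    have hpow : (π / κ) ^ ((d : ℝ) / 2) * s ^ ((d : ℝ) / 2) = ((π / c) ^ (1 / 2 : ℝ)) ^ d := by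
      rw [← mul_rpow (by positivity) hs.le, ← rpow_natCast _ d, ← rpow_mul (by positivity)]
      congr 1
      · rw [hcdef]; field_simp
      · ring
    rw [Finset.prod_mul_distrib, Finset.prod_const, Finset.card_univ, Fintype.card_fin,
      ← Complex.exp_sum, Finset.sum_add_distrib, Complex.exp_add, gaussianSpectrum, ← mul_assoc,
      hpow, norm_smul_latticePoint_sq, inner_latticePoint, mul_pow]
    push_cast
    rw [Finset.sum_neg_distrib, ← Finset.sum_div, ← Finset.mul_sum, ← Finset.mul_sum, hcdef]
    push_cast
    have : (π : ℂ) ^ 2 * (∑ i, (h * j i : ℂ) ^ 2) / (κ / s) =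
        π ^ 2 * (∑ i, (h * j i : ℂ) ^ 2) / κ * s := by
      rw [div_div_eq_mul_div]
      ring
    rw [this]
    ring

/-- Poisson summation for the Matérn kernel. -/
theorem tsum_matern_eq_tsum_fourierMode {d : ℕ} {ν ℓ h : ℝ} (hν : 0 < ν) (hℓ : 0 < ℓ) (hh : 0 < h)
    (x : EuclideanSpace ℝ (Fin d))
    (hspace : Summable fun n : Fin d → ℤ => matern ν ℓ (x + h⁻¹ • latticePoint n))
    (hfreq : Summable fun j : Fin d → ℤ => maternSpectrum d ν ℓ ‖h • latticePoint j‖) :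
    ((∑' n : Fin d → ℤ, matern ν ℓ (x + h⁻¹ • latticePoint n) : ℝ) : ℂ) =
      ∑' j : Fin d → ℤ, fourierMode (matern ν ℓ) h x j := by
  have hκ := maternRate_pos hν hℓ
  have h₁ : ∀ n : Fin d → ℤ, 0 ≤ maternRate ν ℓ * ‖x + h⁻¹ • latticePoint n‖ ^ 2 := fun n => by
    positivity
  -- By positivity the integrals of the norms are the kernel values here and, up to h^d, the
  -- spectrum values below, so the two summability hypotheses are what the exchange needs.
  have hL := integral_tsum_of_summable_integral_norm (μ := volume.restrict (Ioi 0))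
    (F := fun (n : Fin d → ℤ) s => ((gammaWeight ν s *
      exp (-(maternRate ν ℓ * ‖x + h⁻¹ • latticePoint n‖ ^ 2 / s)) : ℝ) : ℂ))
    (fun n => (integrableOn_gammaWeight_mul_exp_neg_div hν (h₁ n)).ofReal) (by
      refine hspace.congr fun n => ?_
      rw [matern_eq_integral hν hℓ]
      refine setIntegral_congr_fun measurableSet_Ioi fun s hs => ?_
      simp only [Complex.norm_real]
      exact (norm_of_nonneg (mul_nonneg (gammaWeight_nonneg hν hs) (exp_pos _).le)).symm)
  have hR := integral_tsum_of_summable_integral_norm (μ := volume.restrict (Ioi 0))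
    (F := fun (j : Fin d → ℤ) s => ((gammaWeight ν s *
      gaussianSpectrum d (maternRate ν ℓ) ‖h • latticePoint j‖ s : ℝ) : ℂ) * ((h : ℂ) ^ d *
        Complex.exp (2 * π * Complex.I * h * (inner ℝ (latticePoint j) x : ℝ))))
    (fun j => (integrableOn_gammaWeight_mul_gaussianSpectrum d hν hκ _).ofReal.mul_const _) (by
      refine (hfreq.mul_right (h ^ d)).congr fun j => ?_
      rw [← integral_gammaWeight_mul_gaussianSpectrum d hν hℓ, ← integral_mul_const]
      refine setIntegral_congr_fun measurableSet_Ioi fun s hs => ?_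
      have : (2 * π * Complex.I * h * (inner ℝ (latticePoint j) x : ℝ) : ℂ) =
          ((2 * π * h * inner ℝ (latticePoint j) x : ℝ) : ℂ) * Complex.I := by
        push_cast
        ring
      simp only [norm_mul, this, Complex.norm_exp_ofReal_mul_I, mul_one, norm_pow,
        Complex.norm_real, norm_of_nonneg hh.le, norm_of_nonneg (gammaWeight_nonneg hν hs),
        norm_of_nonneg (gaussianSpectrum_nonneg hκ hs)])
  rw [Complex.ofReal_tsum]
  calc ∑' n : Fin d → ℤ, ((matern ν ℓ (x + h⁻¹ • latticePoint n) : ℝ) : ℂ)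
      = ∫ s in Ioi 0, ∑' n : Fin d → ℤ, ((gammaWeight ν s *
          exp (-(maternRate ν ℓ * ‖x + h⁻¹ • latticePoint n‖ ^ 2 / s)) : ℝ) : ℂ) := by
        rw [← hL]
        refine tsum_congr fun n => ?_
        rw [integral_complex_ofReal, matern_eq_integral hν hℓ]
    _ = ∫ s in Ioi 0, ∑' j : Fin d → ℤ, ((gammaWeight ν s *
          gaussianSpectrum d (maternRate ν ℓ) ‖h • latticePoint j‖ s : ℝ) : ℂ) * ((h : ℂ) ^ d *
            Complex.exp (2 * π * Complex.I * h * (inner ℝ (latticePoint j) x : ℝ))) := by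
        refine setIntegral_congr_fun measurableSet_Ioi fun s hs => ?_
        have key := tsum_exp_neg_mul_sq_norm_add hκ hs hh x
        simp only [Complex.ofReal_mul, mul_assoc, tsum_mul_left] at key ⊢
        rw [key]
        congr 1
        rw [← tsum_mul_left]
        refine tsum_congr fun j => ?_
        ring
    _ = _ := by
        rw [← hR]
        refine tsum_congr fun j => ?_
        rw [integral_mul_const, integral_complex_ofReal,
          integral_gammaWeight_mul_gaussianSpectrum d hν hℓ, fourierMode,
          kernelFourier_matern hν hℓ]
        ring

/-! ### Decay of the kernel and the aliasing error -/

/-- Since 16/(7e) < 1, the worst case is ν = 1/2, with value about 0.917. -/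
theorem exp_neg_mul_rpow_le {ν : ℝ} (hν : 1 / 2 ≤ ν) : (16 / 7) ^ ν * exp (-ν) ≤ 23 / 25 := by
  have he := exp_one_gt_d9
  have hb : 16 / 7 * exp (-1) ≤ (23 / 25) ^ 2 := by
    rw [exp_neg, ← div_eq_mul_inv, div_le_iff₀ (exp_pos 1)]
    nlinarith
  have hb0 : 0 < 16 / 7 * exp (-1) := by positivity
  calc (16 / 7) ^ ν * exp (-ν) = (16 / 7 * exp (-1)) ^ ν := by
        rw [mul_rpow (by norm_num) (exp_pos _).le, ← exp_mul]
        ring_nf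
    _ ≤ (16 / 7 * exp (-1)) ^ (1 / 2 : ℝ) :=
        rpow_le_rpow_of_exponent_ge hb0 (hb.trans (by norm_num)) hν
    _ ≤ ((23 / 25) ^ 2) ^ (1 / 2 : ℝ) := by gcongr
    _ = 23 / 25 := by
        rw [← rpow_natCast, ← rpow_mul (by norm_num)]
        norm_num

/-- Exponential decay of the Matérn kernel far from the origin. -/
theorem matern_le_exp {d : ℕ} {ν ℓ : ℝ} (hν : 1 / 2 ≤ ν) (hℓ : 0 < ℓ)
    (x : EuclideanSpace ℝ (Fin d)) (hx : 4 * ν ≤ √(2 * ν) * (‖x‖ / ℓ)) :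
    matern ν ℓ x ≤ 23 / 25 * exp (-(√(2 * ν) * (‖x‖ / ℓ) / 2)) := by
  have hν0 : 0 < ν := by linarith
  set z := √(2 * ν) * (‖x‖ / ℓ) with hz
  have hz2 : maternRate ν ℓ * ‖x‖ ^ 2 = z ^ 2 / 4 := by
    rw [hz, mul_pow, sq_sqrt (by positivity), maternRate]
    field_simp
    ring
  -- Of the exponent s, the part 9s/16 is paired with z²/(4s) by AM-GM to give 3z/4. The rest,
  -- 7s/16, keeps the Gamma integral finite and yields (16/7)^ν.
  have hint := integrableOn_gammaWeight_mul_rpow_mul_exp (ν := ν) (p := 0) (r := -(9 / 16))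
    (by simpa) (by norm_num)
  calc matern ν ℓ x
      ≤ ∫ s in Ioi 0, exp (-(3 / 4 * z)) *
          (gammaWeight ν s * (s ^ (0 : ℝ) * exp (-(-(9 / 16) * s)))) := by
        rw [matern_eq_integral hν0 hℓ, hz2]
        refine setIntegral_mono_on
          (integrableOn_gammaWeight_mul_exp_neg_div hν0 (by positivity)) (hint.const_mul _)
          measurableSet_Ioi fun s hs => ?_
        have hs : 0 < s := hs
        rw [rpow_zero, one_mul, mul_left_comm, ← exp_add]
        refine mul_le_mul_of_nonneg_left (exp_le_exp.2 ?_) (gammaWeight_nonneg hν0 hs)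
        have : 9 / 16 * s - 3 / 4 * z + z ^ 2 / 4 / s = (3 / 4 * s - z / 2) ^ 2 / s := by
          field_simp
          ring
        have : 0 ≤ (3 / 4 * s - z / 2) ^ 2 / s := by positivity
        linarith
    _ = exp (-(3 / 4 * z)) * (16 / 7) ^ ν := by
        rw [integral_const_mul, integral_gammaWeight_mul_rpow_mul_exp (by simpa) (by norm_num),
          add_zero, div_self (Gamma_pos_of_pos hν0).ne', one_mul, rpow_neg (by norm_num),
          ← inv_rpow (by norm_num)]
        norm_num
    _ ≤ (16 / 7) ^ ν * exp (-ν) * exp (-(z / 2)) := by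
        -- Of 3z/4, the portion z/4 ≥ ν pays for (16/7)^ν.
        rw [mul_comm, mul_assoc, ← exp_add]
        gcongr
        linarith
    _ ≤ 23 / 25 * exp (-(z / 2)) := by
        gcongr
        exact exp_neg_mul_rpow_le hν

/-- As L ≥ 1 ≥ |x|, the sign of x + Ln is that of n, so each side is a geometric series. The term n
= 0 is replaced by 1, the majorant for coordinates in which the shift vanishes. -/
theorem hasSum_exp_neg_mul_periodic {a L x : ℝ} (ha : 0 < a) (hL : 1 ≤ L) (hx : x ∈ Icc (-1) 1) :
    HasSum (fun n : ℤ => if n = 0 then 1 else exp (-(a * |x + L * n|)))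
      (1 + (exp (-(a * (L + x))) + exp (-(a * (L - x)))) / (1 - exp (-(a * L)))) := by
  have hr : exp (-(a * L)) < 1 := exp_lt_one_iff.2 (by nlinarith)
  have hgeom := hasSum_geometric_of_lt_one (exp_pos (-(a * L))).le hr
  have hpow : ∀ n : ℕ, exp (-(a * L)) ^ n = exp (-(a * L * n)) := fun n => by
    rw [← exp_nat_mul]
    ring_nf
  have hpos : HasSum (fun n : ℕ => if (n : ℤ) = 0 then 1 else exp (-(a * |x + L * (n : ℤ)|)))
      (exp (-(a * (L + x))) * (1 - exp (-(a * L)))⁻¹ + 1) := by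
    have := (hasSum_nat_add_iff (f := fun n : ℕ =>
      if (n : ℤ) = 0 then 1 else exp (-(a * |x + L * (n : ℤ)|)))
      (g := exp (-(a * (L + x))) * (1 - exp (-(a * L)))⁻¹) 1).1 ?_
    · simpa using this
    · refine (congrArg (HasSum · _) (funext fun n => ?_)).mpr
        (hgeom.mul_left (exp (-(a * (L + x)))))
      have : 0 ≤ x + L * (n + 1) := by nlinarith [hx.1, (Nat.cast_nonneg n : (0 : ℝ) ≤ n)]
      rw [if_neg (by omega), hpow, ← exp_add]
      push_cast
      rw [abs_of_nonneg this]
      ring_nf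
  have hneg : HasSum (fun n : ℕ => if -((n : ℤ) + 1) = 0 then 1
      else exp (-(a * |x + L * (-((n : ℤ) + 1) : ℤ)|)))
      (exp (-(a * (L - x))) * (1 - exp (-(a * L)))⁻¹) := by
    refine (congrArg (HasSum · _) (funext fun n => ?_)).mpr
        (hgeom.mul_left (exp (-(a * (L - x)))))
    have : x + L * (-(n + 1)) ≤ 0 := by nlinarith [hx.2, (Nat.cast_nonneg n : (0 : ℝ) ≤ n)]
    rw [if_neg (by omega), hpow, ← exp_add]
    push_cast
    rw [abs_of_nonpos this]
    ring_nf
  have := HasSum.of_nat_of_neg_add_one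
    (f := fun n : ℤ => if n = 0 then 1 else exp (-(a * |x + L * n|))) hpos hneg
  rw [add_div, div_eq_mul_inv, div_eq_mul_inv, ← add_assoc, add_comm 1]
  exact this

/-- The numerator is 2e^{-aL}cosh(ax), largest at |x| = 1. The constants 5/4 = 1 + (1/2)² and 1/2
come from e^{-a} ≤ 1/2. -/
theorem tsum_exp_neg_mul_periodic_le {a L x : ℝ} (ha : log 2 ≤ a) (hL : 1 < L)
    (hx : x ∈ Icc (-1) 1) :
    ∑' n : ℤ, (if n = 0 then 1 else exp (-(a * |x + L * n|))) ≤
      1 + exp (-(a * (L - 1))) * (5 / 4) / (1 - exp (-(a * (L - 1))) / 2) := by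
  have ha0 : 0 < a := (log_pos one_lt_two).trans_le ha
  rw [(hasSum_exp_neg_mul_periodic ha0 hL.le hx).tsum_eq]
  set q := exp (-(a * (L - 1))) with hq
  have hq0 : 0 < q := exp_pos _
  have hq1 : q < 1 := exp_lt_one_iff.2 (by nlinarith)
  have hp : exp (-a) ≤ 1 / 2 := by
    rw [exp_neg, ← one_div]
    exact one_div_le_one_div_of_le two_pos ((log_le_iff_le_exp two_pos).1 ha)
  have hp0 := exp_pos (-a)
  have hden : exp (-(a * L)) = q * exp (-a) := by
    rw [hq, ← exp_add]
    ring_nf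
  have hnum : exp (-(a * (L + x))) + exp (-(a * (L - x))) ≤ q * (1 + exp (-a) ^ 2) := by
    have hcosh : cosh (a * x) ≤ cosh a := by
      rw [cosh_le_cosh, abs_mul, abs_of_pos ha0]
      exact mul_le_of_le_one_right ha0.le (abs_le.2 hx)
    calc exp (-(a * (L + x))) + exp (-(a * (L - x))) = 2 * exp (-(a * L)) * cosh (a * x) := by
          rw [cosh_eq, mul_add, neg_add, exp_add, mul_sub, neg_sub, sub_eq_add_neg, exp_add]
          ring
      _ ≤ 2 * exp (-(a * L)) * cosh a := by gcongr
      _ = q * (1 + exp (-a) ^ 2) := by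
          rw [hden, cosh_eq]
          have : exp (-a) * exp a = 1 := by rw [← exp_add]; simp
          linear_combination q * this
  gcongr 1 + ?_
  refine div_le_div₀ (by positivity) (hnum.trans ?_) (by linarith) ?_
  · gcongr
    nlinarith
  · rw [hden]
    nlinarith

theorem tsum_ne_zero_eq_sub {ι : Type*} [Zero ι] {f : ι → ℝ} (hf : Summable f) :
    ∑' n : {n : ι // n ≠ 0}, f n = ∑' n, f n - f 0 := by
  have := hf.tsum_subtype_add_tsum_subtype_compl {0}
  rw [tsum_singleton] at this
  exact eq_sub_of_add_eq' this

theorem sum_abs_le_sqrt_card_mul_norm {d : ℕ} (y : EuclideanSpace ℝ (Fin d)) :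
    ∑ i, |y i| ≤ √d * ‖y‖ := by
  refine abs_le_of_sq_le_sq' ?_ (by positivity) |>.2
  have := sq_sum_le_card_mul_sum_sq (s := Finset.univ) (f := fun i => |y i|)
  rw [mul_pow, sq_sqrt (Nat.cast_nonneg d), EuclideanSpace.norm_sq_eq]
  simpa using this

theorem abs_apply_le_norm {d : ℕ} (y : EuclideanSpace ℝ (Fin d)) (i : Fin d) : |y i| ≤ ‖y‖ := by
  simpa using PiLp.norm_apply_le y i

theorem latticePoint_shift_apply {d : ℕ} (h : ℝ) (x : EuclideanSpace ℝ (Fin d)) (n : Fin d → ℤ)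
    (i : Fin d) : (x + h⁻¹ • latticePoint n) i = x i + h⁻¹ * n i := by
  simp [latticePoint]

/-- A nonzero coordinate of n moves the point at least h⁻¹ - 1 from the origin, which gives z ≥ 4ν.
Cauchy–Schwarz then splits the exponential over the coordinates. -/
theorem matern_lattice_le_prod {d : ℕ} (hd : 0 < d) {ν ℓ h : ℝ} (hν : 1 / 2 ≤ ν) (hℓ : 0 < ℓ)
    (hL : √(8 * ν) * ℓ ≤ h⁻¹ - 1)
    {x : EuclideanSpace ℝ (Fin d)} (hx : x ∈ cube d) {n : Fin d → ℤ} (hn : n ≠ 0) :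
    matern ν ℓ (x + h⁻¹ • latticePoint n) ≤
      23 / 25 * ∏ i, (if n i = 0 then 1 else exp (-(√(ν / (2 * d)) / ℓ * |x i + h⁻¹ * n i|))) := by
  have hν0 : 0 < ν := by linarith
  have hd' : (0 : ℝ) < d := by exact_mod_cast hd
  set y := x + h⁻¹ • latticePoint n with hy
  have hfar : √(8 * ν) * ℓ ≤ ‖y‖ := by
    obtain ⟨i, hi⟩ := Function.ne_iff.1 hn
    refine (hL.trans ?_).trans (abs_apply_le_norm y i)
    rw [hy, latticePoint_shift_apply]
    have hh : 1 ≤ h⁻¹ := by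
      have : 0 ≤ √(8 * ν) * ℓ := by positivity
      linarith
    have hni : (1 : ℝ) ≤ |(n i : ℝ)| := by exact_mod_cast Int.one_le_abs hi
    have h1 : h⁻¹ ≤ |h⁻¹ * n i| := by
      rw [abs_mul, abs_of_nonneg (by linarith)]
      nlinarith
    have h2 : |x i| ≤ 1 := abs_le.2 (hx i)
    have h3 := abs_sub_abs_le_abs_sub (h⁻¹ * n i) (-x i)
    rw [abs_neg, sub_neg_eq_add, add_comm] at h3
    linarith
  have hz : 4 * ν ≤ √(2 * ν) * (‖y‖ / ℓ) := by
    have : √(8 * ν) ≤ ‖y‖ / ℓ := (le_div_iff₀ hℓ).2 hfar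
    calc 4 * ν = √(2 * ν) * √(8 * ν) := by
          rw [← sqrt_mul (by positivity), show 2 * ν * (8 * ν) = (4 * ν) ^ 2 by ring,
            sqrt_sq (by positivity)]
      _ ≤ _ := by gcongr
  have hrate : √(ν / (2 * d)) * √d = √(2 * ν) / 2 := by
    rw [← sqrt_mul (by positivity), show ν / (2 * d) * d = 2 * ν / 2 ^ 2 by field_simp,
      sqrt_div (by positivity), sqrt_sq (by norm_num)]
  refine (matern_le_exp hν hℓ y hz).trans (mul_le_mul_of_nonneg_left ?_ (by norm_num))
  calc exp (-(√(2 * ν) * (‖y‖ / ℓ) / 2))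
      ≤ exp (-(√(ν / (2 * d)) / ℓ * ∑ i, |y i|)) := by
        refine exp_le_exp.2 (neg_le_neg ?_)
        calc √(ν / (2 * d)) / ℓ * ∑ i, |y i| ≤ √(ν / (2 * d)) / ℓ * (√d * ‖y‖) := by
              gcongr
              exact sum_abs_le_sqrt_card_mul_norm y
          _ = √(2 * ν) * (‖y‖ / ℓ) / 2 := by
              linear_combination ‖y‖ / ℓ * hrate
    _ = ∏ i, exp (-(√(ν / (2 * d)) / ℓ * |y i|)) := by
        rw [← exp_sum, Finset.sum_neg_distrib, Finset.mul_sum]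
    _ ≤ _ := by
        refine Finset.prod_le_prod (fun i _ => (exp_pos _).le) fun i _ => ?_
        split_ifs with hi
        · exact exp_le_one_iff.2 (neg_nonpos.2 (by positivity))
        · rw [hy, latticePoint_shift_apply]

/-- The factor 23/25 matters for d = 1: there (5/4)/(1 - q/2) can reach about 1.53, above the
allowed 3/2. For d = 2, 3 the crude bound q ≤ e^{-1/2} < 0.61 suffices. -/
theorem pow_sub_one_le_of_decay {d : ℕ} (hd : d = 1 ∨ d = 2 ∨ d = 3) {q : ℝ} (hq0 : 0 < q)
    (hq : q ≤ exp (-(1 / √d))) :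
    23 / 25 * ((1 + q * (5 / 4) / (1 - q / 2)) ^ d - 1) ≤ d * 3 ^ d / 2 * q := by
  have he := exp_one_gt_d9
  have hhalf : d ≠ 1 → q ≤ 0.61 := by
    intro h1
    have hs : √(d : ℝ) ≤ 2 := by
      rw [sqrt_le_left (by norm_num)]
      rcases hd with rfl | rfl | rfl <;> norm_num
    have hs0 : 0 < √(d : ℝ) := sqrt_pos.2 (by rcases hd with rfl | rfl | rfl <;> norm_num)
    have h2 : exp (-(1 / √d)) ≤ exp (-(1 / 2)) := by
      gcongr
    refine (hq.trans h2).trans (abs_le_of_sq_le_sq' ?_ (by norm_num)).2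
    rw [← exp_nat_mul, show ((2 : ℕ) : ℝ) * -(1 / 2) = -1 by norm_num, exp_neg]
    refine inv_le_of_inv_le₀ (by norm_num) ?_
    norm_num at he ⊢
    linarith
  rcases hd with rfl | rfl | rfl
  · have hq1 : q ≤ 0.368 := by
      refine hq.trans ?_
      simp only [Nat.cast_one, sqrt_one, div_one, exp_neg]
      refine inv_le_of_inv_le₀ (by norm_num) ?_
      norm_num at he ⊢
      linarith
    have : q * (5 / 4) / (1 - q / 2) ≤ q * 1.55 := by
      rw [div_le_iff₀ (by linarith)]
      nlinarith
    norm_num at this ⊢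
    linarith
  all_goals
    have hq1 := hhalf (by norm_num)
    have ht : q * (5 / 4) / (1 - q / 2) ≤ q * 1.8 := by
      rw [div_le_iff₀ (by linarith)]
      nlinarith
    have ht0 : 0 ≤ q * (5 / 4) / (1 - q / 2) := div_nonneg (by positivity) (by linarith)
    have hpow := pow_le_pow_left₀ (by linarith)
      (by linarith : 1 + q * (5 / 4) / (1 - q / 2) ≤ 1 + q * 1.8)
  · have := hpow 2
    push_cast
    nlinarith
  · have := hpow 3
    push_cast
    nlinarith [mul_pos hq0 hq0]

/-- The aliasing series of the Matérn kernel. -/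
theorem summable_and_tsum_aliasingTerm_le {d : ℕ} (hd : d = 1 ∨ d = 2 ∨ d = 3)
    {ν ℓ : ℝ} (hν : 1 / 2 ≤ ν) (hℓ : 0 < ℓ) (hℓν : ℓ ≤ (log 2)⁻¹ * √(ν / (2 * d)))
    {h : ℝ} (hL : √(8 * ν) * ℓ ≤ h⁻¹ - 1) {x : EuclideanSpace ℝ (Fin d)} (hx : x ∈ cube d) :
    Summable (aliasingTerm (matern ν ℓ) h x) ∧
      ∑' n, aliasingTerm (matern ν ℓ) h x n ≤
        d * 3 ^ d / 2 * exp (-(√(ν / (2 * d)) / ℓ * (h⁻¹ - 1))) := by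
  have hd0 : 0 < d := by omega
  have hd' : (0 : ℝ) < d := by exact_mod_cast hd0
  have hν0 : 0 < ν := by linarith
  set a := √(ν / (2 * d)) / ℓ with ha
  have hlog : 0 < log 2 := log_pos one_lt_two
  have ha2 : log 2 ≤ a := by
    rw [ha, le_div_iff₀ hℓ]
    calc log 2 * ℓ ≤ log 2 * ((log 2)⁻¹ * √(ν / (2 * d))) := by gcongr
      _ = _ := mul_inv_cancel_left₀ hlog.ne' _
  have ha0 : 0 < a := hlog.trans_le ha2
  have hL1 : 1 < h⁻¹ := by
    have : 0 < √(8 * ν) * ℓ := by positivity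
    linarith
  let g : Fin d → ℤ → ℝ := fun i n => if n = 0 then 1 else exp (-(a * |x i + h⁻¹ * n|))
  have hg0 : ∀ i n, 0 ≤ g i n := fun i n => by
    simp only [g]
    split_ifs <;> positivity
  obtain ⟨hsum, hprod⟩ := summable_norm_prod_and_tsum_prod g fun i =>
    (hasSum_exp_neg_mul_periodic ha0 hL1.le (hx i)).summable.norm
  have hsum := hsum.of_norm
  have hdom : ∀ n : {n : Fin d → ℤ // n ≠ 0},
      aliasingTerm (matern ν ℓ) h x n ≤ 23 / 25 * ∏ i, g i (n.1 i) :=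
    fun n => matern_lattice_le_prod hd0 hν hℓ hL hx n.2
  have hsub : Summable fun n : {n : Fin d → ℤ // n ≠ 0} => 23 / 25 * ∏ i, g i (n.1 i) :=
    (hsum.subtype _).mul_left _
  have hal := Summable.of_nonneg_of_le (fun n => matern_nonneg hν0 hℓ _) hdom hsub
  refine ⟨hal, (hal.tsum_le_tsum hdom hsub).trans ?_⟩
  rw [tsum_mul_left, tsum_ne_zero_eq_sub (f := fun n : Fin d → ℤ => ∏ i, g i (n i)) hsum, hprod]
  set q := exp (-(a * (h⁻¹ - 1))) with hq
  have hq' : q ≤ exp (-(1 / √d)) := by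
    refine exp_le_exp.2 (neg_le_neg ?_)
    have e : √(ν / (2 * d)) * √(8 * ν) = 2 * ν / √d := by
      rw [← sqrt_mul (by positivity), show ν / (2 * d) * (8 * ν) = (2 * ν) ^ 2 / d by
        field_simp; ring, sqrt_div (by positivity), sqrt_sq (by positivity)]
    calc 1 / √d ≤ 2 * ν / √d := by gcongr; linarith
      _ = a * (√(8 * ν) * ℓ) := by rw [← e, ha]; field_simp
      _ ≤ _ := by gcongr
  refine le_trans ?_ (pow_sub_one_le_of_decay hd (exp_pos _) hq')
  have hg1 : ∏ i, g i ((0 : Fin d → ℤ) i) = 1 := by simp [g]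
  rw [hg1]
  gcongr
  calc ∏ i, ∑' n, g i n ≤ ∏ _i : Fin d, (1 + q * (5 / 4) / (1 - q / 2)) :=
        Finset.prod_le_prod (fun i _ => tsum_nonneg (hg0 i))
          fun i _ => tsum_exp_neg_mul_periodic_le ha2 hL1 (hx i)
    _ = _ := by simp

theorem exp_neg_le_of_le_inv {d : ℕ} (hd : 0 < d) {ν ℓ ε h : ℝ} (hν : 0 < ν) (hℓ : 0 < ℓ)
    (hε : 0 < ε) (hpos : 0 < h)
    (hh : h ≤ (1 + ℓ * √(2 * d / ν) * log (d * 3 ^ d / ε))⁻¹) :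
    exp (-(√(ν / (2 * d)) / ℓ * (h⁻¹ - 1))) ≤ ε / (d * 3 ^ d) := by
  have hd' : (0 : ℝ) < d := by exact_mod_cast hd
  have h1 : 1 + ℓ * √(2 * d / ν) * log (d * 3 ^ d / ε) ≤ h⁻¹ := by
    -- For large ε the logarithm is negative; the denominator is positive because its inverse
    -- dominates h > 0.
    rw [le_inv_comm₀ (inv_pos.1 (hpos.trans_le hh)) hpos]
    exact hh
  have h2 : √(ν / (2 * d)) * √(2 * d / ν) = 1 := by
    rw [← sqrt_mul (by positivity), show ν / (2 * d) * (2 * d / ν) = 1 by field_simp, sqrt_one]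
  have h3 : log (d * 3 ^ d / ε) ≤ √(ν / (2 * d)) / ℓ * (h⁻¹ - 1) := by
    calc log (d * 3 ^ d / ε)
        = √(ν / (2 * d)) / ℓ * (ℓ * √(2 * d / ν) * log (d * 3 ^ d / ε)) := by
          rw [mul_assoc ℓ, ← mul_assoc, div_mul_cancel₀ _ hℓ.ne', ← mul_assoc, h2, one_mul]
      _ ≤ _ := by gcongr; linarith
  calc exp (-(√(ν / (2 * d)) / ℓ * (h⁻¹ - 1))) ≤ exp (-log (d * 3 ^ d / ε)) := by gcongr
    _ = _ := by rw [exp_neg, exp_log (by positivity), inv_div]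

/-! ### Lattice sums over cubical shells -/

/-- A discrete integral comparison, from log y ≤ y - 1 and 1 + u ≤ e^u; it makes the shell sums
telescope. -/
theorem mul_rpow_neg_succ_le_sub {p M : ℝ} (hp : 0 < p) (hM : 1 ≤ M) :
    p * (M + 1) ^ (-(p + 1)) ≤ M ^ (-p) - (M + 1) ^ (-p) := by
  have hS : 0 < M + 1 := by linarith
  have hy : 0 < M / (M + 1) := by positivity
  have hlog : log (M / (M + 1)) ≤ -(1 / (M + 1)) := by
    refine (log_le_sub_one_of_pos hy).trans (le_of_eq ?_)
    field_simp
    ring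
  have h1 : 1 + p * (1 / (M + 1)) ≤ (M / (M + 1)) ^ (-p) := by
    rw [rpow_def_of_pos hy]
    refine le_trans ?_ (add_one_le_exp _)
    nlinarith
  have h2 : M ^ (-p) = (M + 1) ^ (-p) * (M / (M + 1)) ^ (-p) := by
    rw [← mul_rpow hS.le hy.le, mul_div_cancel₀ _ hS.ne']
  have h3 : (M + 1) ^ (-(p + 1)) = (M + 1) ^ (-p) * (1 / (M + 1)) := by
    rw [show -(p + 1) = -p - 1 by ring, rpow_sub_one hS.ne']
    ring
  have := mul_le_mul_of_nonneg_left h1 (rpow_nonneg hS.le (-p))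
  rw [h2, h3]
  linarith

theorem mem_indexBox {d m : ℕ} {j : Fin d → ℤ} : j ∈ indexBox d m ↔ ∀ i, |j i| ≤ m := by
  simp [indexBox, abs_le]

theorem card_indexBox (d m : ℕ) : (indexBox d m).card = (2 * m + 1) ^ d := by
  simp only [indexBox, Fintype.card_piFinset, Int.card_Icc, Finset.prod_const, Finset.card_univ,
    Fintype.card_fin]
  congr 1
  omega

theorem indexBox_mono (d : ℕ) : Monotone (indexBox d) := fun m n hmn j hj =>
  mem_indexBox.2 fun i => (mem_indexBox.1 hj i).trans (by exact_mod_cast hmn)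

theorem card_indexBox_succ_sdiff (d s : ℕ) :
    ((indexBox d (s + 1) \ indexBox d s).card : ℝ) =
      (2 * (s + 1 : ℝ) + 1) ^ d - (2 * (s + 1 : ℝ) - 1) ^ d := by
  rw [Finset.cast_card_sdiff (indexBox_mono d s.le_succ), card_indexBox, card_indexBox]
  push_cast
  ring

theorem exists_subset_indexBox {d : ℕ} (U : Finset (Fin d → ℤ)) (m : ℕ) :
    ∃ M, m ≤ M ∧ U ⊆ indexBox d M := by
  refine ⟨max m (U.sup fun j => Finset.univ.sup fun i => (j i).natAbs), le_max_left _ _,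
    fun j hj => mem_indexBox.2 fun i => ?_⟩
  have h1 : (j i).natAbs ≤ Finset.univ.sup fun i => (j i).natAbs :=
    Finset.le_sup (f := fun i => (j i).natAbs) (Finset.mem_univ i)
  have h2 : (Finset.univ.sup fun i => (j i).natAbs) ≤
      U.sup fun j => Finset.univ.sup fun i => (j i).natAbs :=
    Finset.le_sup (f := fun j : Fin d → ℤ => Finset.univ.sup fun i => (j i).natAbs) hj
  have h3 := (h1.trans h2).trans (le_max_right m _)
  rw [Int.abs_eq_natAbs]
  exact_mod_cast h3

/-- Shell M + 1 has at most A(M+1)^{d-1} points, each contributing at most C(M+1)^{-(p+d)}, so it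
costs CA(M+1)^{-(p+1)}. -/
theorem sum_indexBox_sdiff_le {d m : ℕ} (hd : 0 < d) (hm : 1 ≤ m) {A C p : ℝ} (hC : 0 ≤ C)
    (hp : 0 < p) (hA0 : 0 ≤ A)
    (hA : ∀ s : ℝ, 1 ≤ s → (2 * s + 1) ^ d - (2 * s - 1) ^ d ≤ A * s ^ (d - 1))
    {g : (Fin d → ℤ) → ℝ}
    (hg : ∀ s : ℕ, ∀ j ∉ indexBox d s, g j ≤ C * (s + 1 : ℝ) ^ (-(p + d)))
    {M : ℕ} (hM : m ≤ M) :
    ∑ j ∈ indexBox d M \ indexBox d m, g j ≤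
      C * A / p * ((m : ℝ) ^ (-p) - (M : ℝ) ^ (-p)) := by
  induction M, hM using Nat.le_induction with
  | base => simp
  | succ M hM ih =>
    have hM1 : (1 : ℝ) ≤ M := by exact_mod_cast hm.trans hM
    have hS : (0 : ℝ) < M + 1 := by positivity
    have hsplit : indexBox d (M + 1) \ indexBox d m =
        (indexBox d M \ indexBox d m) ∪ (indexBox d (M + 1) \ indexBox d M) := by
      rw [Finset.union_comm]
      exact (Finset.sdiff_union_sdiff_cancel (indexBox_mono d M.le_succ) (indexBox_mono d hM)).symm
    have hdisj : Disjoint (indexBox d M \ indexBox d m) (indexBox d (M + 1) \ indexBox d M) :=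
      Finset.disjoint_left.2 fun j h1 h2 =>
        (Finset.mem_sdiff.1 h2).2 (Finset.mem_sdiff.1 h1).1
    have hshell : ∑ j ∈ indexBox d (M + 1) \ indexBox d M, g j ≤
        C * A / p * ((M : ℝ) ^ (-p) - (M + 1 : ℝ) ^ (-p)) := by
      calc ∑ j ∈ indexBox d (M + 1) \ indexBox d M, g j
          ≤ (indexBox d (M + 1) \ indexBox d M).card • (C * (M + 1 : ℝ) ^ (-(p + d))) :=
            Finset.sum_le_card_nsmul _ _ _ fun j hj => hg M j (Finset.mem_sdiff.1 hj).2
        _ ≤ A * (M + 1 : ℝ) ^ (d - 1) * (C * (M + 1 : ℝ) ^ (-(p + d))) := by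
            rw [nsmul_eq_mul, card_indexBox_succ_sdiff]
            gcongr
            exact hA _ (by linarith)
        _ = C * A / p * (p * (M + 1 : ℝ) ^ (-(p + 1))) := by
            have : (M + 1 : ℝ) ^ (-(p + 1)) = (M + 1 : ℝ) ^ (d - 1) * (M + 1 : ℝ) ^ (-(p + d)) := by
              rw [← rpow_natCast, ← rpow_add hS, Nat.cast_sub hd]
              congr 1
              push_cast
              ring
            rw [this]
            field_simp
        _ ≤ _ := by
            gcongr
            exact mul_rpow_neg_succ_le_sub hp hM1
    rw [hsplit, Finset.sum_union hdisj]
    push_cast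
    linarith

theorem summable_and_tsum_off_indexBox_le {d m : ℕ} (hd : 0 < d) (hm : 1 ≤ m) {A C p : ℝ}
    (hC : 0 ≤ C) (hp : 0 < p) (hA0 : 0 ≤ A)
    (hA : ∀ s : ℝ, 1 ≤ s → (2 * s + 1) ^ d - (2 * s - 1) ^ d ≤ A * s ^ (d - 1))
    {g : (Fin d → ℤ) → ℝ} (hg0 : ∀ j, 0 ≤ g j)
    (hg : ∀ s : ℕ, ∀ j ∉ indexBox d s, g j ≤ C * (s + 1 : ℝ) ^ (-(p + d))) :
    (Summable fun j : {j // j ∉ indexBox d m} => g j) ∧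
      ∑' j : {j // j ∉ indexBox d m}, g j ≤ C * A / p * (m : ℝ) ^ (-p) := by
  have hbound : ∀ u : Finset {j // j ∉ indexBox d m},
      ∑ j ∈ u, g j ≤ C * A / p * (m : ℝ) ^ (-p) := by
    intro u
    obtain ⟨M, hmM, hM⟩ := exists_subset_indexBox (u.map (Function.Embedding.subtype _)) m
    calc ∑ j ∈ u, g j = ∑ j ∈ u.map (Function.Embedding.subtype _), g j := by simp
      _ ≤ ∑ j ∈ indexBox d M \ indexBox d m, g j := by
          refine Finset.sum_le_sum_of_subset_of_nonneg (fun j hj => ?_) fun j _ _ => hg0 j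
          refine Finset.mem_sdiff.2 ⟨hM hj, ?_⟩
          obtain ⟨i, _, rfl⟩ := Finset.mem_map.1 hj
          exact i.2
      _ ≤ C * A / p * ((m : ℝ) ^ (-p) - (M : ℝ) ^ (-p)) :=
          sum_indexBox_sdiff_le hd hm hC hp hA0 hA hg hmM
      _ ≤ _ := by
          gcongr
          exact sub_le_self _ (by positivity)
  have hs := summable_of_sum_le (fun j : {j // j ∉ indexBox d m} => hg0 j) hbound
  exact ⟨hs, hs.tsum_le_of_sum_le hbound⟩

theorem succ_le_norm_latticePoint {d s : ℕ} {j : Fin d → ℤ} (hj : j ∉ indexBox d s) :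
    (s + 1 : ℝ) ≤ ‖latticePoint j‖ := by
  rw [mem_indexBox] at hj
  push Not at hj
  obtain ⟨i, hi⟩ := hj
  refine le_trans ?_ (abs_apply_le_norm (latticePoint j) i)
  simp only [latticePoint]
  exact_mod_cast hi

/-! ### Spectral decay, Gamma function inequalities and the truncation error -/

/-- Drop the 1 in 1 + π²r²/κ; the d-dependent powers of h and κ then cancel, leaving π^{-d/2}. -/
theorem pow_mul_maternSpectrum_le {d : ℕ} {ν ℓ h R r : ℝ} (hν : 0 < ν) (hℓ : 0 < ℓ) (hh : 0 < h)
    (hR : 0 < R) (hr : h * R ≤ r) :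
    h ^ d * maternSpectrum d ν ℓ r ≤
      Gamma (ν + d / 2) / Gamma ν * (π ^ ((d : ℝ) / 2))⁻¹ *
        (maternRate ν ℓ / (π * h) ^ 2) ^ ν * R ^ (-(2 * ν + d)) := by
  have hκ := maternRate_pos hν hℓ
  have hΓ := Gamma_pos_of_pos hν
  have hΓ' := Gamma_pos_of_pos (by positivity : 0 < ν + d / 2)
  set κ := maternRate ν ℓ with hκdef
  set B := κ / (π * h) ^ 2 with hB
  have hB0 : 0 < B := by positivity
  have hbase : B⁻¹ * R ^ 2 ≤ 1 + π ^ 2 * r ^ 2 / κ := by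
    have h1 : (h * R) ^ 2 ≤ r ^ 2 := by gcongr
    have h2 : B⁻¹ * R ^ 2 = π ^ 2 * (h * R) ^ 2 / κ := by
      rw [hB]
      field_simp
    rw [h2]
    have : π ^ 2 * (h * R) ^ 2 / κ ≤ π ^ 2 * r ^ 2 / κ := by gcongr
    linarith
  have hdecay : (1 + π ^ 2 * r ^ 2 / κ) ^ (-(ν + d / 2)) ≤
      B ^ ν * B ^ ((d : ℝ) / 2) * R ^ (-(2 * ν + d)) := by
    refine (rpow_le_rpow_of_nonpos (by positivity) hbase
      (neg_nonpos.2 (by positivity))).trans (le_of_eq ?_)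
    rw [mul_rpow (by positivity) (by positivity), inv_rpow hB0.le, rpow_neg hB0.le, inv_inv,
      rpow_add hB0, ← rpow_natCast, ← rpow_mul hR.le]
    congr 2
    push_cast
    ring
  have hconst : h ^ d * (π / κ) ^ ((d : ℝ) / 2) * B ^ ((d : ℝ) / 2) = (π ^ ((d : ℝ) / 2))⁻¹ := by
    have : h ^ d = (h ^ 2) ^ ((d : ℝ) / 2) := by
      rw [← rpow_natCast h 2, ← rpow_mul hh.le, ← rpow_natCast]
      congr 1
      push_cast
      ring
    rw [this, ← mul_rpow (by positivity) (by positivity), ← mul_rpow (by positivity) hB0.le,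
      ← inv_rpow (by positivity)]
    congr 1
    rw [hB]
    field_simp
  calc h ^ d * maternSpectrum d ν ℓ r
      ≤ h ^ d * ((π / κ) ^ ((d : ℝ) / 2) * (Gamma (ν + d / 2) / Gamma ν) *
          (B ^ ν * B ^ ((d : ℝ) / 2) * R ^ (-(2 * ν + d)))) := by
        rw [maternSpectrum, ← hκdef]
        gcongr
    _ = _ := by
        rw [← hconst]
        ring

/-- Log-convexity: x and 3/2 lie between 1 and x + 1/2 and have the same sum as these endpoints, and
Γ(1) = 1. -/
theorem Gamma_mul_Gamma_three_halves_le {x : ℝ} (hx : 1 ≤ x) :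
    Gamma x * Gamma (3 / 2) ≤ Gamma (x + 1 / 2) := by
  rcases hx.eq_or_lt with rfl | hx
  · norm_num
  have hd : 0 < x - 1 / 2 := by linarith
  have ha : 0 < (x - 1) / (x - 1 / 2) := div_pos (by linarith) hd
  have hb : 0 < (1 / 2) / (x - 1 / 2) := by positivity
  have hab : (1 / 2) / (x - 1 / 2) + (x - 1) / (x - 1 / 2) = 1 := by
    rw [← add_div, div_eq_one_iff_eq hd.ne']
    ring
  have h1 := Gamma_mul_add_mul_le_rpow_Gamma_mul_rpow_Gamma one_pos
    (by linarith : 0 < x + 1 / 2) hb ha hab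
  have h2 := Gamma_mul_add_mul_le_rpow_Gamma_mul_rpow_Gamma one_pos
    (by linarith : 0 < x + 1 / 2) ha hb (by rw [add_comm]; exact hab)
  have e1 : (1 / 2) / (x - 1 / 2) * 1 + (x - 1) / (x - 1 / 2) * (x + 1 / 2) = x := by
    linear_combination hab + div_mul_cancel₀ (x - 1) hd.ne'
  have e2 : (x - 1) / (x - 1 / 2) * 1 + (1 / 2) / (x - 1 / 2) * (x + 1 / 2) = 3 / 2 := by
    linear_combination hab + div_mul_cancel₀ (1 / 2) hd.ne'
  rw [e1, Gamma_one, one_rpow, one_mul] at h1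
  rw [e2, Gamma_one, one_rpow, one_mul] at h2
  have hpos := Gamma_pos_of_pos (by linarith : 0 < x + 1 / 2)
  calc Gamma x * Gamma (3 / 2)
      ≤ Gamma (x + 1 / 2) ^ ((x - 1) / (x - 1 / 2)) *
          Gamma (x + 1 / 2) ^ ((1 / 2) / (x - 1 / 2)) :=
        mul_le_mul h1 h2 (Gamma_pos_of_pos (by norm_num)).le (by positivity)
    _ = Gamma (x + 1 / 2) := by rw [← rpow_add hpos, add_comm ((x - 1) / _), hab, rpow_one]

theorem two_mul_Gamma_add_half_le {ν : ℝ} (hν : 1 / 2 ≤ ν) :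
    2 * Gamma (ν + 1 / 2) ≤ 5.12 ^ ν * Gamma (ν + 1) := by
  have hΓ := Gamma_pos_of_pos (by linarith : 0 < ν + 1)
  have h1 := Gamma_mul_Gamma_three_halves_le (by linarith : 1 ≤ ν + 1 / 2)
  have h32 : Gamma (3 / 2) = √π / 2 := by
    rw [show (3 / 2 : ℝ) = 1 / 2 + 1 by norm_num, Gamma_add_one (by norm_num), Gamma_one_half_eq]
    ring
  have hsq : 0 < √π := sqrt_pos.2 pi_pos
  rw [h32, show ν + 1 / 2 + 1 / 2 = ν + 1 by ring] at h1
  have h2 : 4 ≤ 5.12 ^ ν * √π := by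
    -- This is nearly tight: 5.12π is about 16.08, so ν = 1/2 leaves little room in the constant
    -- 1.6.
    calc (4 : ℝ) ≤ √5.12 * √π := by
          rw [← sqrt_mul (by norm_num)]
          refine le_sqrt_of_sq_le ?_
          have := pi_gt_d2
          norm_num at this ⊢
          linarith
      _ ≤ 5.12 ^ ν * √π := by
          gcongr
          rw [sqrt_eq_rpow]
          exact rpow_le_rpow_of_exponent_le (by norm_num) hν
  have h3 : 2 * Gamma (ν + 1 / 2) * √π ≤ 4 * Gamma (ν + 1) := by linarith
  refine le_of_mul_le_mul_right (h3.trans ?_) hsq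
  nlinarith

/-- Midpoint log-convexity between ν + 1 and ν + 2 gives the factor √(ν+1), which is at most e^ν. -/
theorem Gamma_add_three_halves_le {ν : ℝ} (hν : 0 < ν) :
    Gamma (ν + 3 / 2) ≤ 5.12 ^ ν * Gamma (ν + 1) := by
  have hΓ := Gamma_pos_of_pos (by linarith : 0 < ν + 1)
  have h1 := Gamma_mul_add_mul_le_rpow_Gamma_mul_rpow_Gamma (by linarith : 0 < ν + 1)
    (by linarith : 0 < ν + 1 + 1) one_half_pos one_half_pos (by norm_num)
  rw [show 1 / 2 * (ν + 1) + 1 / 2 * (ν + 1 + 1) = ν + 3 / 2 by ring,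
    Gamma_add_one (by linarith : ν + 1 ≠ 0), mul_rpow (by linarith) hΓ.le, mul_left_comm,
    ← rpow_add hΓ] at h1
  norm_num at h1
  refine h1.trans ?_
  gcongr
  calc (ν + 1) ^ (1 / 2 : ℝ) ≤ (ν + 1) ^ (1 : ℝ) :=
        rpow_le_rpow_of_exponent_le (by linarith) (by norm_num)
    _ = ν + 1 := rpow_one _
    _ ≤ exp ν := add_one_le_exp ν
    _ = exp 1 ^ ν := by rw [← exp_mul, one_mul]
    _ ≤ _ := by
        gcongr
        have := exp_one_lt_d9
        norm_num at this ⊢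
        linarith

/-- The shell counts are 2, 8s and 24s² + 2 ≤ 26s², hence A = 2, 8, 26. -/
theorem exists_shell_constant {d : ℕ} (hd : d = 1 ∨ d = 2 ∨ d = 3) {ν : ℝ} (hν : 1 / 2 ≤ ν) :
    ∃ A : ℝ, 0 ≤ A ∧
      (∀ s : ℝ, 1 ≤ s → (2 * s + 1) ^ d - (2 * s - 1) ^ d ≤ A * s ^ (d - 1)) ∧
      Gamma (ν + d / 2) * A ≤ d * 5 ^ (d - 1) * (5.12 ^ ν * Gamma (ν + 1)) := by
  have hΓ := Gamma_pos_of_pos (by linarith : 0 < ν + 1)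
  rcases hd with rfl | rfl | rfl
  · refine ⟨2, by norm_num, fun s hs => by norm_num, ?_⟩
    have := two_mul_Gamma_add_half_le hν
    push_cast
    linarith
  · refine ⟨8, by norm_num, fun s hs => by norm_num; linarith, ?_⟩
    have h1 : (1 : ℝ) ≤ 5.12 ^ ν := one_le_rpow (by norm_num) (by linarith)
    push_cast
    rw [div_self two_ne_zero]
    norm_num at h1 ⊢
    nlinarith
  · refine ⟨26, by norm_num, fun s hs => by norm_num; nlinarith, ?_⟩
    have := Gamma_add_three_halves_le (by linarith : 0 < ν)
    have h0 := Gamma_pos_of_pos (by linarith : 0 < ν + 3 / 2)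
    push_cast
    norm_num at this ⊢
    linarith

theorem summable_and_tsum_maternSpectrum_le {d : ℕ} (hd : d = 1 ∨ d = 2 ∨ d = 3)
    {ν ℓ : ℝ} (hν : 1 / 2 ≤ ν) (hℓ : 0 < ℓ) {ε : ℝ} (hε : 0 < ε) {h : ℝ} (hh : 0 < h) {m : ℕ}
    (hm : (d * 5 ^ (d - 1) / (π ^ ((d : ℝ) / 2) * ε)) ^ (1 / (2 * ν)) *
      (1.6 * √ν / (π * h * ℓ)) ≤ (m : ℝ)) :
    (Summable fun j : {j : Fin d → ℤ // j ∉ indexBox d m} =>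
      h ^ d * maternSpectrum d ν ℓ ‖h • latticePoint j.1‖) ∧
      ∑' j : {j : Fin d → ℤ // j ∉ indexBox d m},
        h ^ d * maternSpectrum d ν ℓ ‖h • latticePoint j.1‖ ≤ ε / 2 := by
  have hd0 : 0 < d := by omega
  have hd' : (0 : ℝ) < d := by exact_mod_cast hd0
  have hν0 : 0 < ν := by linarith
  have hκ := maternRate_pos hν0 hℓ
  have hΓ := Gamma_pos_of_pos hν0
  have hΓ' := Gamma_pos_of_pos (by positivity : 0 < ν + d / 2)
  obtain ⟨A, hA0, hA, hAΓ⟩ := exists_shell_constant hd hν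
  set R := d * 5 ^ (d - 1) / (π ^ ((d : ℝ) / 2) * ε) with hR
  have hR0 : 0 < R := by positivity
  set b := (maternRate ν ℓ / (π * h) ^ 2) ^ ν with hb
  have hb0 : 0 < b := by positivity
  have hm0 : (0 : ℝ) < m := lt_of_lt_of_le (by positivity) hm
  have hm1 : 1 ≤ m := by exact_mod_cast hm0
  -- Here 5.12 = 2 · 1.6², because κ = ν/(2ℓ²).
  have hmpow : R * (5.12 ^ ν * b) ≤ (m : ℝ) ^ (2 * ν) := by
    refine le_trans (le_of_eq ?_) (rpow_le_rpow (by positivity) hm (by positivity : 0 ≤ 2 * ν))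
    rw [mul_rpow (by positivity) (by positivity), ← rpow_mul hR0.le,
      one_div_mul_cancel (by positivity), rpow_one, rpow_mul (by positivity), hb,
      ← mul_rpow (by norm_num) (by positivity)]
    congr 2
    rw [rpow_two, div_pow, mul_pow _ √ν, sq_sqrt hν0.le, maternRate]
    field_simp
    norm_num
  obtain ⟨hs, hle⟩ := summable_and_tsum_off_indexBox_le (m := m) (p := 2 * ν)
    (C := Gamma (ν + d / 2) / Gamma ν * (π ^ ((d : ℝ) / 2))⁻¹ * b)
    (g := fun j => h ^ d * maternSpectrum d ν ℓ ‖h • latticePoint j‖) hd0 hm1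
    (by positivity) (by positivity) hA0 hA
    (fun j => mul_nonneg (by positivity) (maternSpectrum_nonneg hν0 hℓ _))
    (fun s j hj => pow_mul_maternSpectrum_le hν0 hℓ hh (by positivity) (by
      rw [norm_smul, norm_of_nonneg hh.le]
      gcongr
      exact succ_le_norm_latticePoint hj))
  refine ⟨hs, hle.trans ?_⟩
  have hinv : (m : ℝ) ^ (-(2 * ν)) ≤ (R * (5.12 ^ ν * b))⁻¹ := by
    rw [rpow_neg hm0.le]
    exact inv_anti₀ (by positivity) hmpow
  have hΓ1 : Gamma (ν + 1) = ν * Gamma ν := Gamma_add_one hν0.ne'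
  have hpi : 0 < π ^ ((d : ℝ) / 2) := by positivity
  have h5 : (0 : ℝ) < 5.12 ^ ν := by positivity
  calc Gamma (ν + d / 2) / Gamma ν * (π ^ ((d : ℝ) / 2))⁻¹ * b * A / (2 * ν) *
        (m : ℝ) ^ (-(2 * ν))
      ≤ Gamma (ν + d / 2) / Gamma ν * (π ^ ((d : ℝ) / 2))⁻¹ * b * A / (2 * ν) *
        (R * (5.12 ^ ν * b))⁻¹ := by gcongr
    _ = ε / 2 * (Gamma (ν + d / 2) * A) /
          (d * 5 ^ (d - 1) * (5.12 ^ ν * Gamma (ν + 1))) := by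
        rw [hΓ1, hR]
        generalize (5.12 : ℝ) ^ ν = c at h5 ⊢
        generalize π ^ ((d : ℝ) / 2) = w at hpi ⊢
        field_simp
    _ ≤ ε / 2 := by
        rw [hΓ1] at hAΓ ⊢
        rw [mul_div_assoc]
        exact mul_le_of_le_one_right (by positivity) ((div_le_one (by positivity)).2 hAΓ)

/-! ### Error decomposition and conclusion -/

theorem norm_fourierMode_matern {d : ℕ} {ν ℓ h : ℝ} (hν : 0 < ν) (hℓ : 0 < ℓ) (hh : 0 < h)
    (x : EuclideanSpace ℝ (Fin d)) (j : Fin d → ℤ) :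
    ‖fourierMode (matern ν ℓ) h x j‖ = h ^ d * maternSpectrum d ν ℓ ‖h • latticePoint j‖ := by
  have : (2 * π * Complex.I * h * (inner ℝ (latticePoint j) x : ℝ) : ℂ) =
      ((2 * π * h * inner ℝ (latticePoint j) x : ℝ) : ℂ) * Complex.I := by
    push_cast
    ring
  rw [fourierMode, kernelFourier_matern hν hℓ, this, norm_mul, norm_mul,
    Complex.norm_exp_ofReal_mul_I, mul_one, norm_pow, Complex.norm_real, Complex.norm_real,
    norm_of_nonneg hh.le, norm_of_nonneg (maternSpectrum_nonneg hν hℓ _)]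

theorem summable_of_summable_ne_zero {ι : Type*} [Zero ι] {f : ι → ℝ}
    (hf : Summable fun n : {n : ι // n ≠ 0} => f n) : Summable f :=
  (Set.finite_singleton (0 : ι)).summable_compl_iff.1 hf

/-- Poisson summation with n = 0 split off in space and J_m in frequency. Both removed sets are
finite, so summability passes to the full lattices. -/
theorem equispacedFourier_sub_matern {d : ℕ} {ν ℓ h : ℝ} (hν : 0 < ν) (hℓ : 0 < ℓ) (hh : 0 < h)
    {m : ℕ} (x : EuclideanSpace ℝ (Fin d)) (hspace : Summable (aliasingTerm (matern ν ℓ) h x))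
    (hfreq : Summable (truncationTerm (matern ν ℓ) h m x)) :
    equispacedFourier (matern ν ℓ) h m x - (matern ν ℓ x : ℂ) =
      ((∑' n, aliasingTerm (matern ν ℓ) h x n : ℝ) : ℂ) -
        ∑' j, truncationTerm (matern ν ℓ) h m x j := by
  set f : (Fin d → ℤ) → ℝ := fun n => matern ν ℓ (x + h⁻¹ • latticePoint n) with hf
  have hf0 : f 0 = matern ν ℓ x := by
    have : (latticePoint 0 : EuclideanSpace ℝ (Fin d)) = 0 := by
      ext i
      simp [latticePoint]
    simp [hf, this]
  have hfs : Summable f := summable_of_summable_ne_zero hspace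
  have hms : Summable (fourierMode (matern ν ℓ) h x) :=
    (Finset.summable_compl_iff (indexBox d m)).1 hfreq
  have hspec : Summable fun j : Fin d → ℤ => maternSpectrum d ν ℓ ‖h • latticePoint j‖ := by
    have := hms.norm
    simp only [norm_fourierMode_matern hν hℓ hh] at this
    exact (summable_mul_left_iff (by positivity)).1 this
  have hpoisson := tsum_matern_eq_tsum_fourierMode hν hℓ hh x hfs hspec
  have hal : ∑' n, aliasingTerm (matern ν ℓ) h x n = ∑' n, f n - f 0 := tsum_ne_zero_eq_sub hfs
  have htr := hms.sum_add_tsum_subtype_compl (indexBox d m)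
  rw [hal, hf0, Complex.ofReal_sub, hpoisson, ← htr, equispacedFourier]
  simp only [truncationTerm]
  ring

theorem corollary4p5 (d : ℕ) (hd : d = 1 ∨ d = 2 ∨ d = 3)
    (ν ℓ : ℝ) (hν : 1 / 2 ≤ ν) (hℓ : 0 < ℓ)
    (hℓν : ℓ ≤ (Real.log 2)⁻¹ * Real.sqrt (ν / (2 * d)))
    (ε : ℝ) (hε : 0 < ε)
    (h : ℝ) (hpos : 0 < h)
    (hh₀ : h ≤ (1 + Real.sqrt (8 * ν) * ℓ)⁻¹)
    (hh : h ≤ (1 + ℓ * Real.sqrt (2 * d / ν) * Real.log (d * 3 ^ d / ε))⁻¹) :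
    (∀ x ∈ cube d,
      Summable (aliasingTerm (matern ν ℓ) h x) ∧
        |∑' n, aliasingTerm (matern ν ℓ) h x n| ≤ ε / 2) ∧
    ∀ m : ℕ,
      (d * 5 ^ (d - 1) / (Real.pi ^ ((d : ℝ) / 2) * ε)) ^ (1 / (2 * ν)) *
          (1.6 * Real.sqrt ν / (Real.pi * h * ℓ)) ≤ (m : ℝ) →
        (∀ x : EuclideanSpace ℝ (Fin d),
          Summable (truncationTerm (matern ν ℓ) h m x) ∧
            ‖∑' j, truncationTerm (matern ν ℓ) h m x j‖ ≤ ε / 2) ∧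
        ∀ x ∈ cube d,
          ‖equispacedFourier (matern ν ℓ) h m x - (matern ν ℓ x : ℂ)‖ ≤ ε := by
  have hd0 : 0 < d := by omega
  have hd' : (0 : ℝ) < d := by exact_mod_cast hd0
  have hν0 : 0 < ν := by linarith
  have hL : √(8 * ν) * ℓ ≤ h⁻¹ - 1 := by
    have := (le_inv_comm₀ hpos (by positivity)).1 hh₀
    linarith
  have halias : ∀ x ∈ cube d, Summable (aliasingTerm (matern ν ℓ) h x) ∧
      |∑' n, aliasingTerm (matern ν ℓ) h x n| ≤ ε / 2 := by
    intro x hx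
    obtain ⟨hs, hle⟩ := summable_and_tsum_aliasingTerm_le hd hν hℓ hℓν hL hx
    refine ⟨hs, ?_⟩
    have h0 : 0 ≤ ∑' n, aliasingTerm (matern ν ℓ) h x n :=
      tsum_nonneg fun n => matern_nonneg hν0 hℓ _
    rw [abs_of_nonneg h0]
    calc ∑' n, aliasingTerm (matern ν ℓ) h x n
        ≤ d * 3 ^ d / 2 * exp (-(√(ν / (2 * d)) / ℓ * (h⁻¹ - 1))) := hle
      _ ≤ d * 3 ^ d / 2 * (ε / (d * 3 ^ d)) := by
          gcongr
          exact exp_neg_le_of_le_inv hd0 hν0 hℓ hε hpos hh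
      _ = ε / 2 := by field_simp
  refine ⟨halias, fun m hm => ?_⟩
  obtain ⟨hs, hle⟩ := summable_and_tsum_maternSpectrum_le hd hν hℓ hε hpos hm
  have htrunc : ∀ x : EuclideanSpace ℝ (Fin d), Summable (truncationTerm (matern ν ℓ) h m x) ∧
      ‖∑' j, truncationTerm (matern ν ℓ) h m x j‖ ≤ ε / 2 := by
    intro x
    have hnorm : ∀ j, ‖truncationTerm (matern ν ℓ) h m x j‖ =
        h ^ d * maternSpectrum d ν ℓ ‖h • latticePoint j.1‖ :=
      fun j => norm_fourierMode_matern hν0 hℓ hpos x j.1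
    have hsn : Summable fun j => ‖truncationTerm (matern ν ℓ) h m x j‖ :=
      hs.congr fun j => (hnorm j).symm
    exact ⟨hsn.of_norm, (norm_tsum_le_tsum_norm hsn).trans ((tsum_congr hnorm).trans_le hle)⟩
  refine ⟨htrunc, fun x hx => ?_⟩
  rw [equispacedFourier_sub_matern hν0 hℓ hpos x (halias x hx).1 (htrunc x).1]
  refine (norm_sub_le _ _).trans ?_
  rw [Complex.norm_real, norm_eq_abs]
  linarith [(halias x hx).2, (htrunc x).2]
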